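/- A family of $s$ distinct sets $F_1,\dots,F_s$ is a sunflower with $s$ petals and core $C$ if $C=\bigcap_{u=1}^s F_u$ and $F_i\cap F_j=C$ for all $i\ne j$. For $s\ge 2$ let $\phi(s,t)$ be the maximum size of a family of $t$-element sets that contains no sunflower with $s$ petals (with arbitrary core). Let $[n]=\{1,\dots,n\}$ and let $\binom{[n]}{k}$ be the family of all $k$-element subsets of $[n]$. Theorem. Let $n,k,s,t$ be integers with $s\ge 2$ and $1\le t\le k\le n$. (1) Suppose that $n/k\ge 2^{18}s(t+1)\log_2(n/k)$ and $n\ge 2^{15}sk\log_2 k$. If $\mathcal F\subset\binom{[n]}{k}$ contains no sunflower with $s$ petals and core of size at most $t-1$, then $$|\mathcal F|\le \phi(s,t)\binom{n-t}{k-t}+(2^{14}s\log_2 t)^t\cdot\frac{2^{19}s(t+1)\log_2(n/k)}{n/k}\cdot\binom{n-t}{k-t}.$$ (2) The bound is tight up to second-order terms: there is a family $\mathcal F\subset\binom{[n]}{k}$ that contains no sunflower with $s$ petals and core of size at most $t-1$ and satisfies $$|\mathcal F|\ge \phi(s,t)\binom{n-t}{k-t}-\frac{t\,\phi(s,t)^2}{n/k}\binom{n-t}{k-t},$$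 and, if moreover $n>t\,\phi(s,t)$, also $$|\mathcal F|\ge \phi(s,t)\binom{n-t}{k-t}-\frac{t\,\phi(s,t)^2(k-t)}{n-t}\binom{n-t}{k-t}.$$ -/

import Mathlib

/-- `IsSunflower s S C`: the family `S` is a sunflower with `s` petals and core `C`, i.e. `S` consists
of `s` (distinct) sets, `C` is the intersection of all members of `S`, and any two distinct members
of `S` intersect exactly in `C`. -/
def IsSunflower {α : Type*} [DecidableEq α] (s : ℕ) (S : Finset (Finset α)) (C : Finset α) : Prop :=
  S.card = s ∧ (∀ x, x ∈ C ↔ ∀ A ∈ S, x ∈ A) ∧ ∀ A ∈ S, ∀ B ∈ S, A ≠ B → A ∩ B = C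

/-- The family `F` contains a sunflower with `s` petals (and arbitrary core). -/
def ContainsSunflower {α : Type*} [DecidableEq α] (s : ℕ) (F : Finset (Finset α)) : Prop :=
  ∃ S ⊆ F, ∃ C, IsSunflower s S C

/-- The family `F` contains a sunflower with `s` petals and core of size at most `c`. -/
def ContainsSunflowerCoreLE {α : Type*} [DecidableEq α] (s c : ℕ) (F : Finset (Finset α)) : Prop :=
  ∃ S ⊆ F, ∃ C, IsSunflower s S C ∧ C.card ≤ c

/-- The possible sizes of `t`-uniform families of sets (of natural numbers, without loss of
generality) that contain no sunflower with `s` petals. -/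
def sunflowerFreeSizes (s t : ℕ) : Set ℕ :=
  {m | ∃ T : Finset (Finset ℕ), (∀ A ∈ T, A.card = t) ∧ ¬ ContainsSunflower s T ∧ T.card = m}

/-- `sunflowerPhi s t` is the maximum size of a `t`-uniform family that contains no sunflower with
`s` petals. The maximum exists for `2 ≤ s`, see `sunflowerPhi_isGreatest`. -/
noncomputable def sunflowerPhi (s t : ℕ) : ℕ := sSup (sunflowerFreeSizes s t)

theorem sunflowerFree_card_le (s : ℕ) (hs : 2 ≤ s) (t : ℕ) : ∀ T : Finset (Finset ℕ),
    (∀ A ∈ T, A.card = t) → ¬ ContainsSunflower s T → T.card ≤ t.factorial * s ^ t := by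
  induction t with
  | zero =>
    intro T hT _
    have hsub : T ⊆ {∅} := by
      intro A hA
      simpa using hT A hA
    simpa using Finset.card_le_card hsub
  | succ t ih =>
    intro T hT hfree
    classical
    obtain ⟨M, hMmem, hMmax⟩ := Finset.exists_max_image
      (T.powerset.filter fun M => ∀ A ∈ M, ∀ B ∈ M, A ≠ B → A ∩ B = ∅) Finset.card
      ⟨∅, by simp⟩
    simp only [Finset.mem_filter, Finset.mem_powerset] at hMmem hMmax
    obtain ⟨hMT, hMdisj⟩ := hMmem
    have hMcard : M.card ≤ s := by
      by_contra hlt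
      obtain ⟨S, hSM, hS⟩ := Finset.exists_subset_card_eq (le_of_lt (not_le.mp hlt))
      refine hfree ⟨S, hSM.trans hMT, ∅, hS, fun x => ⟨by simp, fun hx => ?_⟩,
        fun A hA B hB => hMdisj A (hSM hA) B (hSM hB)⟩
      obtain ⟨A, hA, B, hB, hAB⟩ := Finset.one_lt_card.mp (by omega : 1 < S.card)
      rw [← hMdisj A (hSM hA) B (hSM hB) hAB]
      exact Finset.mem_inter.mpr ⟨hx A hA, hx B hB⟩
    have hU : (M.biUnion id).card ≤ s * (t + 1) := by
      refine (Finset.card_biUnion_le_card_mul M id (t + 1) fun A hA => ?_).trans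
        (Nat.mul_le_mul_right _ hMcard)
      exact (hT A (hMT hA)).le
    have hmeet : ∀ A ∈ T, ∃ x ∈ M.biUnion id, x ∈ A := by
      intro A hA
      by_contra hno
      push Not at hno
      have hdis : ∀ B ∈ M, A ∩ B = ∅ := by
        intro B hB
        ext x
        simp only [Finset.mem_inter, Finset.notMem_empty, iff_false, not_and]
        intro hxA hxB
        exact hno x (Finset.mem_biUnion.mpr ⟨B, hB, hxB⟩) hxA
      have hAM : A ∉ M := by
        intro hAM
        have h0 := hdis A hAM
        rw [Finset.inter_self] at h0
        have := hT A hA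
        simp [h0] at this
      have hle := hMmax (insert A M) ⟨Finset.insert_subset hA hMT, by
        intro X hX Y hY hXY
        rcases Finset.mem_insert.mp hX with hXA | hXM
        · rcases Finset.mem_insert.mp hY with hYA | hYM
          · exact absurd (hXA.trans hYA.symm) hXY
          · rw [hXA]; exact hdis Y hYM
        · rcases Finset.mem_insert.mp hY with hYA | hYM
          · rw [hYA, Finset.inter_comm]; exact hdis X hXM
          · exact hMdisj X hXM Y hYM hXY⟩
      rw [Finset.card_insert_of_notMem hAM] at hle
      omega
    have hcover : T ⊆ (M.biUnion id).biUnion fun x => T.filter fun A => x ∈ A := by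
      intro A hA
      obtain ⟨x, hxU, hxA⟩ := hmeet A hA
      exact Finset.mem_biUnion.mpr ⟨x, hxU, Finset.mem_filter.mpr ⟨hA, hxA⟩⟩
    have hlink : ∀ x, (T.filter fun A => x ∈ A).card ≤ t.factorial * s ^ t := by
      intro x
      have hinj : Set.InjOn (fun A : Finset ℕ => A.erase x) (T.filter fun A => x ∈ A) := by
        intro A hA B hB hAB
        simp only [Finset.coe_filter, Set.mem_ofPred_eq] at hA hB
        rw [← Finset.insert_erase hA.2, ← Finset.insert_erase hB.2]
        exact congrArg (insert x) hAB
      rw [← Finset.card_image_of_injOn hinj]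
      refine ih _ ?_ ?_
      · intro A hA
        obtain ⟨B, hB, rfl⟩ := Finset.mem_image.mp hA
        rw [Finset.mem_filter] at hB
        rw [Finset.card_erase_of_mem hB.2, hT B hB.1, Nat.add_sub_cancel]
      · rintro ⟨S, hST, C, hScard, hC, hSpair⟩
        have hS : ∀ A ∈ S, x ∉ A ∧ insert x A ∈ T := by
          intro A hA
          obtain ⟨B, hB, rfl⟩ := Finset.mem_image.mp (hST hA)
          rw [Finset.mem_filter] at hB
          exact ⟨Finset.notMem_erase x B, by rw [Finset.insert_erase hB.2]; exact hB.1⟩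
        refine hfree ⟨S.image (insert x), ?_, insert x C, ?_, ?_, ?_⟩
        · intro A hA
          obtain ⟨B, hB, rfl⟩ := Finset.mem_image.mp hA
          exact (hS B hB).2
        · rw [Finset.card_image_of_injOn, hScard]
          intro A hA B hB hAB
          rw [← Finset.erase_insert (hS A hA).1, ← Finset.erase_insert (hS B hB).1]
          exact congrArg (fun Z => Finset.erase Z x) hAB
        · intro y
          by_cases hy : y = x <;> simp [hy, hC]
        · intro A hA B hB hAB
          obtain ⟨A', hA', rfl⟩ := Finset.mem_image.mp hA
          obtain ⟨B', hB', rfl⟩ := Finset.mem_image.mp hB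
          rw [← Finset.insert_inter_distrib, hSpair A' hA' B' hB' fun h => hAB (by rw [h])]
    calc T.card ≤ _ := Finset.card_le_card hcover
      _ ≤ (M.biUnion id).card * (t.factorial * s ^ t) :=
        Finset.card_biUnion_le_card_mul _ _ _ fun x _ => hlink x
      _ ≤ s * (t + 1) * (t.factorial * s ^ t) := Nat.mul_le_mul_right _ hU
      _ = (t + 1).factorial * s ^ (t + 1) := by rw [Nat.factorial_succ]; ring

theorem sunflowerPhi_isGreatest (s t : ℕ) (hs : 2 ≤ s) :
    IsGreatest (sunflowerFreeSizes s t) (sunflowerPhi s t) := by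
  have hbdd : BddAbove (sunflowerFreeSizes s t) := by
    refine ⟨t.factorial * s ^ t, ?_⟩
    rintro m ⟨T, hT, hfree, rfl⟩
    exact sunflowerFree_card_le s hs t T hT hfree
  have hne : (sunflowerFreeSizes s t).Nonempty := by
    refine ⟨0, ∅, by simp, ?_, by simp⟩
    rintro ⟨S, hS, C, hcard, -⟩
    rw [Finset.subset_empty.mp hS, Finset.card_empty] at hcard
    omega
  exact ⟨Nat.sSup_mem hne hbdd, fun m hm => le_csSup hbdd hm⟩

/-! Upper bound, t ≥ 2: spread approximation. Put x = n/k and q ≈ (t+1) log₂ x, and let T collect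
the sets X with |X| ≤ q over which F has an r-spread subfamily. If s members of T had a common
pairwise intersection C with |C| < t, members of F could be chosen in their spread subfamilies so
that the added parts are disjoint, and F would contain a sunflower with core C. So T has no
sunflower with core smaller than t, and each of its members has at least t elements
(`exists_isApproximation`). The sets of F above no member of T are negligible: they would
concentrate on a set of more than q elements, which r ≤ x/2 makes expensive (`leftover_card_le`).

The rest of F is counted through T, where X accounts for at most x^{-(|X|-t)} C(n-t, k-t) sets
(`card_covered_le`). The t-element members of T are sunflower-free, hence at most φ(s,t) in number:
the main term. For i > t, replacing overcrowded bunches of T by their common part gives degree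
bounds (`exists_reduced_approximation`), and these make a too large layer spread over a set of size
less than t, so that it contains a sunflower (`card_layer_le`). The i-th layer therefore has at most
(2^11 s log₂ t)^t (2D)^{i-t} members, with D of order sq, and the error is a geometric series of
ratio 2D/x ≤ 1/2.

Disjoint members come from the spread lemma `card_colorings_missing_le`. Colour the ground set at
random and uncover the colour classes one at a time, replacing each set of the family by a smallest
remainder available inside it. Each round multiplies the expected remainder by at most 5/8
(`sum_fragStep_le`), so logarithmically many classes usually cover a whole member; disjoint groups
of colours give disjoint members.

For t = 1 the error term is zero because log₂ 1 = 0. The exact bound (s-1) C(n-1, k-1) comes from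
Katona's cycle method (`card_le_of_no_disjoint`).

Lower bound: place an extremal t-uniform family with support U inside [n] and take all k-sets whose
trace on U belongs to it (`exists_large_family`). -/

/-! ### Spread families and fragments -/

/-- `H` is `κ`-spread relative to the set `X`: all members contain `X`, and every superset `Y` of `X`
lies in at most a `κ ^ (-|Y \ X|)` fraction of the members. -/
def IsSpreadOver {α : Type*} [DecidableEq α] (κ : ℝ) (X : Finset α) (H : Finset (Finset α)) : Prop :=
  H.Nonempty ∧ (∀ A ∈ H, X ⊆ A) ∧
    ∀ Y, X ⊆ Y → κ ^ (Y \ X).card * (H.filter fun A => Y ⊆ A).card ≤ H.card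

/-- S itself is a candidate, so a minimum exists. Competitors are restricted to |f S'| ≤ |f S|
because `sum_fragStep_le` needs the source of the remainder to be no larger than f S. -/
theorem exists_fragment {α : Type*} [DecidableEq α] (H : Finset (Finset α))
    (f : Finset α → Finset α) (W : Finset α) :
    ∃ g : Finset α → Finset α, ∀ S ∈ H,
      (∃ S' ∈ H, g S = f S' \ W ∧ (f S').card ≤ (f S).card) ∧ g S ⊆ f S ∧
      ∀ S' ∈ H, f S' \ W ⊆ f S → (f S').card ≤ (f S).card → (g S).card ≤ (f S' \ W).card := by
  have key : ∀ S, ∃ T : Finset α, S ∈ H →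
      (∃ S' ∈ H, T = f S' \ W ∧ (f S').card ≤ (f S).card) ∧ T ⊆ f S ∧
      ∀ S' ∈ H, f S' \ W ⊆ f S → (f S').card ≤ (f S).card → T.card ≤ (f S' \ W).card := by
    intro S
    by_cases hS : S ∈ H
    · obtain ⟨S', hS', hmin⟩ := Finset.exists_min_image
        (H.filter fun S' => f S' \ W ⊆ f S ∧ (f S').card ≤ (f S).card)
        (fun S' => (f S' \ W).card)
        ⟨S, Finset.mem_filter.mpr ⟨hS, Finset.sdiff_subset, le_rfl⟩⟩
      rw [Finset.mem_filter] at hS'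
      exact ⟨f S' \ W, fun _ => ⟨⟨S', hS'.1, rfl, hS'.2.2⟩, hS'.2.1, fun S'' h1 h2 h3 =>
        hmin S'' (Finset.mem_filter.mpr ⟨h1, h2, h3⟩)⟩⟩
    · exact ⟨∅, fun h => absurd h hS⟩
  choose g hg using key
  exact ⟨g, hg⟩

/-- One round of shrinking: `f S` is replaced by a smallest set `f S' \ W` inside `f S`, over the
members `S'` of `H` with `|f S'| ≤ |f S|`. -/
noncomputable def fragStep {α : Type*} [DecidableEq α] (H : Finset (Finset α))
    (f : Finset α → Finset α) (W : Finset α) : Finset α → Finset α :=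
  Classical.choose (exists_fragment H f W)

theorem fragStep_spec {α : Type*} [DecidableEq α] (H : Finset (Finset α))
    (f : Finset α → Finset α) (W : Finset α) : ∀ S ∈ H,
      (∃ S' ∈ H, fragStep H f W S = f S' \ W ∧ (f S').card ≤ (f S).card) ∧ fragStep H f W S ⊆ f S ∧
      ∀ S' ∈ H, f S' \ W ⊆ f S → (f S').card ≤ (f S).card →
        (fragStep H f W S).card ≤ (f S' \ W).card :=
  Classical.choose_spec (exists_fragment H f W)

/-! ### One round of shrinking under a random colouring -/

/-- The colour class of `j`. -/
def colorClass {α γ : Type*} [Fintype α] [DecidableEq γ] (c : α → γ) (j : γ) : Finset α :=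
  Finset.univ.filter fun x => c x = j

theorem mem_colorClass {α γ : Type*} [Fintype α] [DecidableEq γ] (c : α → γ) (j : γ) (x : α) :
    x ∈ colorClass c j ↔ c x = j := by
  simp [colorClass]

/-- The colouring `c` with the elements of `T` recoloured by `j`. -/
def recolor {α γ : Type*} [DecidableEq α] (c : α → γ) (T : Finset α) (j : γ) : α → γ :=
  fun x => if x ∈ T then j else c x

/-- A colouring is recovered from its recolouring together with its values on T, and there are
|γ|^|T| possibilities for those. -/
theorem card_recolor_preimage_le {α γ : Type*} [Fintype α] [DecidableEq α] [Fintype γ]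
    [DecidableEq γ] (T : Finset α) (j : γ) (P Q : (α → γ) → Prop) [DecidablePred P]
    [DecidablePred Q] (h : ∀ c, P c → Q (recolor c T j)) :
    (Finset.univ.filter P).card ≤ Fintype.card γ ^ T.card * (Finset.univ.filter Q).card := by
  have h1 : (Finset.univ.filter P).card ≤
      ((Finset.univ : Finset (T → γ)) ×ˢ (Finset.univ.filter Q)).card := by
    refine Finset.card_le_card_of_injOn (fun c => (fun x : T => c x, recolor c T j)) ?_ ?_
    · intro c hc
      have hc' : P c := by simpa using hc
      simpa using h c hc'
    · intro c _ d _ hcd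
      simp only [Prod.mk.injEq] at hcd
      funext x
      by_cases hx : x ∈ T
      · exact congrFun hcd.1 ⟨x, hx⟩
      · simpa [recolor, hx] using congrFun hcd.2 x
  simpa using h1

/-- There are at most 2^|K| subsets, and each one with more than |K|/2 elements contributes at most
4^{-(|K|+1)}. For empty K no T qualifies. -/
theorem sum_large_subsets_le {α : Type*} [DecidableEq α] (K : Finset α) (lam : ℝ) (h0 : 0 ≤ lam)
    (h1 : lam ≤ 1 / 32) :
    ∑ T ∈ K.powerset.filter (fun T => K.card < 2 * T.card), (T.card : ℝ) * lam ^ T.card ≤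
      if K.Nonempty then 1 / 8 else 0 := by
  split_ifs with hK
  · have hb : ∀ T ∈ K.powerset.filter (fun T => K.card < 2 * T.card),
        (T.card : ℝ) * lam ^ T.card ≤ (1 / 4) ^ (K.card + 1) := by
      intro T hT
      rw [Finset.mem_filter] at hT
      have hc : (T.card : ℝ) ≤ 2 ^ T.card := by exact_mod_cast Nat.lt_two_pow_self.le
      calc (T.card : ℝ) * lam ^ T.card ≤ 2 ^ T.card * (1 / 32) ^ T.card := by gcongr
        _ = (1 / 4) ^ (2 * T.card) := by rw [← mul_pow, pow_mul]; norm_num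
        _ ≤ (1 / 4) ^ (K.card + 1) :=
          pow_le_pow_of_le_one (by norm_num) (by norm_num) (by omega)
    have hK1 : 1 ≤ K.card := hK.card_pos
    calc _ ≤ _ := Finset.sum_le_card_nsmul _ _ _ hb
      _ ≤ (2 : ℝ) ^ K.card * (1 / 4) ^ (K.card + 1) := by
        rw [nsmul_eq_mul]
        gcongr
        have := Finset.card_filter_le K.powerset (fun T => K.card < 2 * T.card)
        rw [Finset.card_powerset] at this
        exact_mod_cast this
      _ = (1 / 2) ^ K.card * (1 / 4) := by rw [pow_succ, ← mul_assoc, ← mul_pow]; norm_num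
      _ ≤ (1 / 2) ^ 1 * (1 / 4) := by
        gcongr ?_ * _
        exact pow_le_pow_of_le_one (by norm_num) (by norm_num) hK1
      _ = 1 / 8 := by norm_num
  · rw [Finset.not_nonempty_iff_eq_empty] at hK
    subst hK
    simp [Finset.sum_filter]

-- Remainders of at most half the old size account for 1/2. A larger remainder T is charged to the
-- colouring in which T receives colour j: it becomes a large subset of one set K determined by the
-- new colouring alone. Recolouring costs |γ|^|T|, spreadness gains κ^{-|T|}, and summing over large
-- subsets of K leaves 1/8. The hypothesis `hinv` says that `Φ` does not notice the recolouring.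
set_option maxHeartbeats 1000000 in
theorem sum_fragStep_le {α γ : Type*} [Fintype α] [DecidableEq α] [Fintype γ] [DecidableEq γ]
    (H : Finset (Finset α)) (κ : ℝ) (hκ0 : 0 < κ) (hκ : 32 * (Fintype.card γ : ℝ) ≤ κ)
    (hH : IsSpreadOver κ ∅ H) (Φ : (α → γ) → Finset α → Finset α) (j : γ)
    (hsub : ∀ c, ∀ S ∈ H, Φ c S ⊆ S)
    (hinv : ∀ c, ∀ S ∈ H, ∀ T ⊆ Φ c S, Φ (recolor c T j) = Φ c) :
    ∑ c, ∑ S ∈ H, ((fragStep H (Φ c) (colorClass c j) S).card : ℝ) ≤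
      5 / 8 * ∑ c, ∑ S ∈ H, ((Φ c S).card : ℝ) := by
  classical
  set g : (α → γ) → Finset α → Finset α := fun c => fragStep H (Φ c) (colorClass c j) with hg
  have hspec := fun c => fragStep_spec H (Φ c) (colorClass c j)
  -- a smallest value of `Φ c` inside the colour class
  have hK : ∀ c, ∃ K : Finset α,
      (∀ S ∈ H, Φ c S ⊆ colorClass c j → K.card ≤ (Φ c S).card) ∧
      ((∃ S ∈ H, Φ c S ⊆ colorClass c j) →
        ∃ S ∈ H, Φ c S ⊆ colorClass c j ∧ K = Φ c S) := by
    intro c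
    by_cases h : ∃ S ∈ H, Φ c S ⊆ colorClass c j
    · obtain ⟨S, hS, hmin⟩ := Finset.exists_min_image
        (H.filter fun S => Φ c S ⊆ colorClass c j) (fun S => (Φ c S).card)
        (by obtain ⟨S, h1, h2⟩ := h; exact ⟨S, Finset.mem_filter.mpr ⟨h1, h2⟩⟩)
      rw [Finset.mem_filter] at hS
      exact ⟨Φ c S, fun S' h1 h2 => hmin S' (Finset.mem_filter.mpr ⟨h1, h2⟩),
        fun _ => ⟨S, hS.1, hS.2, rfl⟩⟩
    · exact ⟨∅, fun S h1 h2 => by simp, fun h' => absurd h' h⟩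
  choose K hKmin hKmem using hK
  let Bad : Finset α → (α → γ) → Prop := fun T c => ∃ S ∈ H, g c S = T ∧ (Φ c S).card < 2 * T.card
  let Good : Finset α → (α → γ) → Prop := fun T c => T ⊆ K c ∧ (K c).card < 2 * T.card
  -- After recolouring, Φ c S' lies inside class j, so the chosen smallest value K has |K| ≤ |Φ c
  -- S'| ≤ |Φ c S| < 2|T|. What K had outside the old class lies in T, and equals T by minimality of
  -- the remainder.
  have hBG : ∀ T c, Bad T c → Good T (recolor c T j) := by
    rintro T c ⟨S, hS, hgT, hlt⟩
    obtain ⟨⟨S', hS', hgS', hS'le⟩, hgsub, hgmin⟩ := hspec c S hS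
    have hΦ : Φ (recolor c T j) = Φ c := hinv c S hS T (by rw [← hgT]; exact hgsub)
    have hcls : colorClass (recolor c T j) j = colorClass c j ∪ T := by
      ext x
      by_cases hx : x ∈ T <;> simp [colorClass, recolor, hx]
    have hTS' : T = Φ c S' \ colorClass c j := by rw [← hgT]; exact hgS'
    have hgT' : fragStep H (Φ c) (colorClass c j) S = T := hgT
    rw [hgT'] at hgsub hgmin
    have hS'in : Φ (recolor c T j) S' ⊆ colorClass (recolor c T j) j := by
      rw [hΦ, hcls, hTS']
      intro x hx
      by_cases hx' : x ∈ colorClass c j <;> simp [hx, hx']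
    obtain ⟨S₀, hS₀, hS₀in, hKS₀⟩ := hKmem (recolor c T j) ⟨S', hS', hS'in⟩
    rw [hΦ] at hKS₀
    rw [hΦ, hcls] at hS₀in
    have hsd : Φ c S₀ \ colorClass c j ⊆ T := by
      intro x hx
      rw [Finset.mem_sdiff] at hx
      rcases Finset.mem_union.mp (hS₀in hx.1) with h | h
      · exact absurd h hx.2
      · exact h
    have hle : (Φ c S₀).card ≤ (Φ c S').card := by
      have := hKmin (recolor c T j) S' hS' hS'in
      rwa [hKS₀, hΦ] at this
    have hTe : Φ c S₀ \ colorClass c j = T :=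
      Finset.eq_of_subset_of_card_le hsd (hgmin S₀ hS₀ (hsd.trans hgsub) (hle.trans hS'le))
    refine ⟨?_, ?_⟩
    · rw [hKS₀, ← hTe]
      exact Finset.sdiff_subset
    · rw [hKS₀]
      omega
  have hpt : ∀ c, ∀ S ∈ H, ((g c S).card : ℝ) ≤ 1 / 2 * ((Φ c S).card : ℝ) +
      if (Φ c S).card < 2 * (g c S).card then ((g c S).card : ℝ) else 0 := by
    intro c S _
    split_ifs with h
    · have : (0 : ℝ) ≤ (Φ c S).card := Nat.cast_nonneg _
      linarith
    · have : (2 : ℝ) * (g c S).card ≤ (Φ c S).card := by exact_mod_cast not_lt.mp h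
      linarith
  -- Every S with remainder T contains T, so spreadness leaves at most κ^{-|T|} |H| such S.
  have hlarge : ∀ c, (∑ S ∈ H, if (Φ c S).card < 2 * (g c S).card then ((g c S).card : ℝ) else 0) ≤
      ∑ T, if Bad T c then (T.card : ℝ) * ((1 / κ) ^ T.card * H.card) else 0 := by
    intro c
    rw [← Finset.sum_fiberwise H (g c)]
    refine Finset.sum_le_sum fun T _ => ?_
    split_ifs with hB
    · have hcard : ((H.filter fun S => g c S = T).card : ℝ) ≤ (1 / κ) ^ T.card * H.card := by
        have h1 : (H.filter fun S => g c S = T).card ≤ (H.filter fun S => T ⊆ S).card := by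
          refine Finset.card_le_card fun S hS => ?_
          rw [Finset.mem_filter] at hS ⊢
          exact ⟨hS.1, by rw [← hS.2]; exact (hspec c S hS.1).2.1.trans (hsub c S hS.1)⟩
        have h2 := hH.2.2 T (Finset.empty_subset _)
        rw [Finset.sdiff_empty] at h2
        have h3 : ((H.filter fun S => T ⊆ S).card : ℝ) ≤ H.card / κ ^ T.card := by
          rw [le_div_iff₀ (by positivity)]
          linarith
        calc _ ≤ ((H.filter fun S => T ⊆ S).card : ℝ) := by exact_mod_cast h1
          _ ≤ _ := h3
          _ = _ := by rw [one_div, inv_pow]; ring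
      calc _ ≤ ∑ S ∈ H.filter (fun S => g c S = T), (T.card : ℝ) := by
            refine Finset.sum_le_sum fun S hS => ?_
            rw [(Finset.mem_filter.mp hS).2]
            split_ifs <;> simp
        _ = (H.filter fun S => g c S = T).card * (T.card : ℝ) := by simp
        _ ≤ _ := by rw [mul_comm]; gcongr
    · refine le_of_eq (Finset.sum_eq_zero fun S hS => ?_)
      rw [Finset.mem_filter] at hS
      rw [if_neg]
      exact fun h => hB ⟨S, hS.1, hS.2, by rw [← hS.2]; exact h⟩
  set M : ℝ := (Fintype.card γ : ℝ) with hM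
  have hM0 : 0 ≤ M := Nat.cast_nonneg _
  have hlam : M / κ ≤ 1 / 32 := by
    rw [div_le_iff₀ hκ0]; linarith
  have hsum : ∑ c, (∑ T, if Bad T c then (T.card : ℝ) * ((1 / κ) ^ T.card * H.card) else 0) ≤
      ∑ c, H.card * (if (K c).Nonempty then (1 / 8 : ℝ) else 0) := by
    rw [Finset.sum_comm]
    calc _ ≤ ∑ T : Finset α, ∑ c, if Good T c then
          (T.card : ℝ) * ((M / κ) ^ T.card * H.card) else 0 := by
          refine Finset.sum_le_sum fun T _ => ?_
          rw [← Finset.sum_filter, ← Finset.sum_filter, Finset.sum_const, Finset.sum_const,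
            nsmul_eq_mul, nsmul_eq_mul]
          have h1 : ((Finset.univ.filter (Bad T)).card : ℝ) ≤
              M ^ T.card * (Finset.univ.filter (Good T)).card := by
            rw [hM]
            exact_mod_cast card_recolor_preimage_le T j (Bad T) (Good T) (hBG T)
          calc _ ≤ (M ^ T.card * (Finset.univ.filter (Good T)).card) *
                ((T.card : ℝ) * ((1 / κ) ^ T.card * H.card)) := by gcongr
            _ = _ := by simp only [div_pow, one_pow]; ring
      _ = ∑ c, ∑ T : Finset α, if Good T c then
          (T.card : ℝ) * ((M / κ) ^ T.card * H.card) else 0 := Finset.sum_comm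
      _ ≤ _ := by
          refine Finset.sum_le_sum fun c _ => ?_
          have h1 := sum_large_subsets_le (K c) (M / κ) (by positivity) hlam
          have h2 : (Finset.univ.filter fun T => Good T c) =
              (K c).powerset.filter (fun T => (K c).card < 2 * T.card) := by
            ext T
            simp [Good]
          rw [← Finset.sum_filter, h2, mul_comm (H.card : ℝ)]
          refine le_trans (le_of_eq ?_) (mul_le_mul_of_nonneg_right h1 (Nat.cast_nonneg _))
          rw [Finset.sum_mul]
          exact Finset.sum_congr rfl fun T _ => by ring
  -- If K is nonempty then no Φ c S is empty, since an empty value would lie in the colour class and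
  -- beat K. Hence |H| is at most the total size of the values.
  have hne : ∀ c, H.card * (if (K c).Nonempty then (1 / 8 : ℝ) else 0) ≤
      1 / 8 * ∑ S ∈ H, ((Φ c S).card : ℝ) := by
    intro c
    split_ifs with hKc
    · have h1 : ∀ S ∈ H, (1 : ℝ) ≤ (Φ c S).card := by
        intro S hS
        have : (Φ c S) ≠ ∅ := by
          intro h0
          have := hKmin c S hS (by rw [h0]; exact Finset.empty_subset _)
          rw [h0, Finset.card_empty] at this
          have := hKc.card_pos
          omega
        exact_mod_cast (Finset.nonempty_iff_ne_empty.mpr this).card_pos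
      have := Finset.sum_le_sum h1
      rw [Finset.sum_const, nsmul_eq_mul, mul_one] at this
      linarith
    · rw [mul_zero]
      exact mul_nonneg (by norm_num) (Finset.sum_nonneg fun _ _ => Nat.cast_nonneg _)
  calc _ ≤ ∑ c, ∑ S ∈ H, (1 / 2 * ((Φ c S).card : ℝ) +
        if (Φ c S).card < 2 * (g c S).card then ((g c S).card : ℝ) else 0) :=
        Finset.sum_le_sum fun c _ => Finset.sum_le_sum fun S hS => hpt c S hS
    _ = 1 / 2 * ∑ c, ∑ S ∈ H, ((Φ c S).card : ℝ) + ∑ c, ∑ S ∈ H,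
        (if (Φ c S).card < 2 * (g c S).card then ((g c S).card : ℝ) else 0) := by
        rw [Finset.mul_sum, ← Finset.sum_add_distrib]
        refine Finset.sum_congr rfl fun c _ => ?_
        rw [Finset.mul_sum, ← Finset.sum_add_distrib]
    _ ≤ 1 / 2 * ∑ c, ∑ S ∈ H, ((Φ c S).card : ℝ) +
        1 / 8 * ∑ c, ∑ S ∈ H, ((Φ c S).card : ℝ) := by
        refine add_le_add le_rfl ?_
        rw [Finset.mul_sum _ _ (1 / 8 : ℝ)]
        exact (Finset.sum_le_sum fun c _ => hlarge c).trans
          (hsum.trans (Finset.sum_le_sum fun c _ => hne c))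
    _ = _ := by ring

/-! ### Iterated shrinking and the spread lemma -/

/-- Iterated shrinking along a list of sets, the last set first. -/
noncomputable def frag {α : Type*} [DecidableEq α] (H : Finset (Finset α)) :
    List (Finset α) → Finset α → Finset α
  | [] => id
  | W :: l => fragStep H (frag H l) W

theorem frag_subset {α : Type*} [DecidableEq α] (H : Finset (Finset α)) (l : List (Finset α)) :
    ∀ S ∈ H, frag H l S ⊆ S := by
  induction l with
  | nil => intro S _; exact Finset.Subset.refl _
  | cons W l ih => intro S hS; exact (fragStep_spec H (frag H l) W S hS).2.1.trans (ih S hS)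

theorem notMem_of_mem_frag {α : Type*} [DecidableEq α] (H : Finset (Finset α))
    (l : List (Finset α)) : ∀ S ∈ H, ∀ x ∈ frag H l S, ∀ W ∈ l, x ∉ W := by
  induction l with
  | nil => simp
  | cons W l ih =>
    intro S hS x hx V hV
    obtain ⟨⟨S', hS', he, -⟩, hsub, -⟩ := fragStep_spec H (frag H l) W S hS
    rcases List.mem_cons.mp hV with rfl | hV
    · have hx' : x ∈ fragStep H (frag H l) V S := hx
      rw [he] at hx'
      exact (Finset.mem_sdiff.mp hx').2
    · exact ih S hS x (hsub hx) V hV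

/-- An empty fragment thus exhibits a member of H covered by the uncovered sets. -/
theorem exists_subset_of_frag {α : Type*} [DecidableEq α] (H : Finset (Finset α))
    (l : List (Finset α)) : ∀ S ∈ H, ∃ S' ∈ H, ∀ x ∈ S', x ∈ frag H l S ∨ ∃ W ∈ l, x ∈ W := by
  induction l with
  | nil => intro S hS; exact ⟨S, hS, fun x hx => Or.inl hx⟩
  | cons W l ih =>
    intro S hS
    obtain ⟨⟨S', hS', he, -⟩, -, -⟩ := fragStep_spec H (frag H l) W S hS
    obtain ⟨S'', hS'', h⟩ := ih S' hS'
    refine ⟨S'', hS'', fun x hx => ?_⟩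
    rcases h x hx with h1 | ⟨V, hV, hxV⟩
    · by_cases hW : x ∈ W
      · exact Or.inr ⟨W, List.mem_cons_self, hW⟩
      · refine Or.inl ?_
        change x ∈ fragStep H (frag H l) W S
        rw [he]
        exact Finset.mem_sdiff.mpr ⟨h1, hW⟩
    · exact Or.inr ⟨V, List.mem_cons_of_mem _ hV, hxV⟩

/-- The colour classes of `col 0, …, col (m - 1)`, in reverse order. -/
def colorHistory {α γ : Type*} [Fintype α] [DecidableEq γ] (c : α → γ) (col : ℕ → γ) :
    ℕ → List (Finset α)
  | 0 => []
  | m + 1 => colorClass c (col m) :: colorHistory c col m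

theorem mem_colorHistory {α γ : Type*} [Fintype α] [DecidableEq γ] (c : α → γ) (col : ℕ → γ)
    (m : ℕ) (W : Finset α) : W ∈ colorHistory c col m ↔ ∃ i < m, W = colorClass c (col i) := by
  induction m with
  | zero => simp [colorHistory]
  | succ m ih =>
    simp only [colorHistory, List.mem_cons, ih, Nat.lt_succ_iff_lt_or_eq]
    constructor
    · rintro (h | ⟨i, hi, h⟩)
      · exact ⟨m, Or.inr rfl, h⟩
      · exact ⟨i, Or.inl hi, h⟩
    · rintro ⟨i, hi | rfl, h⟩
      · exact Or.inr ⟨i, hi, h⟩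
      · exact Or.inl h

theorem colorHistory_congr {α γ : Type*} [Fintype α] [DecidableEq γ] (c d : α → γ) (col : ℕ → γ)
    (m : ℕ) (h : ∀ i < m, colorClass c (col i) = colorClass d (col i)) :
    colorHistory c col m = colorHistory d col m := by
  induction m with
  | zero => rfl
  | succ m ih =>
    simp only [colorHistory]
    rw [h m (Nat.lt_succ_self m), ih fun i hi => h i (hi.trans (Nat.lt_succ_self m))]

theorem sum_frag_le {α γ : Type*} [Fintype α] [DecidableEq α] [Fintype γ] [DecidableEq γ]
    (H : Finset (Finset α)) (κ : ℝ) (hκ0 : 0 < κ) (hκ : 32 * (Fintype.card γ : ℝ) ≤ κ)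
    (hH : IsSpreadOver κ ∅ H) (k : ℕ) (hk : ∀ S ∈ H, S.card ≤ k) (col : ℕ → γ) (m : ℕ)
    (hcol : Set.InjOn col (Set.Iio m)) :
    ∑ c : α → γ, ∑ S ∈ H, ((frag H (colorHistory c col m) S).card : ℝ) ≤
      (5 / 8) ^ m * (k * H.card * (Fintype.card γ : ℝ) ^ Fintype.card α) := by
  induction m with
  | zero =>
    have h1 : ∀ c : α → γ, ∑ S ∈ H, ((frag H (colorHistory c col 0) S).card : ℝ) ≤
        H.card * k := by
      intro c
      rw [← nsmul_eq_mul]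
      exact Finset.sum_le_card_nsmul _ _ _ fun S hS => by exact_mod_cast hk S hS
    calc _ ≤ _ := Finset.sum_le_sum fun c _ => h1 c
      _ = _ := by simp; ring
  | succ m ih =>
    have hlt : m ∈ Set.Iio (m + 1) := Nat.lt_succ_self m
    -- Invariance holds because a fragment avoids all classes already uncovered: giving its elements
    -- the new colour `col m` changes none of the earlier classes.
    have step := sum_fragStep_le H κ hκ0 hκ hH (fun c => frag H (colorHistory c col m)) (col m)
      (fun c => frag_subset H _) (by
        intro c S hS T hT
        have : colorHistory (recolor c T (col m)) col m = colorHistory c col m := by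
          refine colorHistory_congr _ _ _ _ fun i hi => ?_
          have hne : col m ≠ col i := fun h => by
            have := hcol hlt (show i ∈ Set.Iio (m + 1) from hi.trans (Nat.lt_succ_self m)) h
            omega
          ext x
          by_cases hx : x ∈ T
          · have := notMem_of_mem_frag H _ S hS x (hT hx) (colorClass c (col i))
              ((mem_colorHistory c col m _).mpr ⟨i, hi, rfl⟩)
            rw [mem_colorClass] at this ⊢
            rw [mem_colorClass, recolor, if_pos hx]
            exact iff_of_false hne this
          · rw [mem_colorClass, mem_colorClass, recolor, if_neg hx]
        simp only [this])
    have := ih (hcol.mono fun i hi => lt_trans hi (Nat.lt_succ_self m))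
    calc _ ≤ _ := step
      _ ≤ 5 / 8 * ((5 / 8) ^ m * (k * H.card * (Fintype.card γ : ℝ) ^ Fintype.card α)) := by
        gcongr
      _ = _ := by ring

/-- The spread lemma: if `H` is spread, few colourings have no member of `H` inside the union of
the `m` colour classes `col 0, …, col (m - 1)`. -/
theorem card_colorings_missing_le {α γ : Type*} [Fintype α] [DecidableEq α] [Fintype γ]
    [DecidableEq γ] (H : Finset (Finset α)) (κ : ℝ) (hκ0 : 0 < κ)
    (hκ : 32 * (Fintype.card γ : ℝ) ≤ κ) (hH : IsSpreadOver κ ∅ H) (k : ℕ)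
    (hk : ∀ S ∈ H, S.card ≤ k) (col : ℕ → γ) (m : ℕ) (hcol : Set.InjOn col (Set.Iio m))
    (P : (α → γ) → Prop) [DecidablePred P]
    (hP : ∀ c, P c → ∀ S ∈ H, ∃ x ∈ S, ∀ i < m, c x ≠ col i) :
    ((Finset.univ.filter P).card : ℝ) ≤
      (5 / 8) ^ m * k * (Fintype.card γ : ℝ) ^ Fintype.card α := by
  have hpos : (0 : ℝ) < H.card := by exact_mod_cast hH.1.card_pos
  have h1 := sum_frag_le H κ hκ0 hκ hH k hk col m hcol
  -- Markov's inequality: for a colouring satisfying P no fragment is empty, so the fragments have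
  -- total size at least |H|.
  have h2 : ∑ c ∈ Finset.univ.filter P, (H.card : ℝ) ≤
      ∑ c : α → γ, ∑ S ∈ H, ((frag H (colorHistory c col m) S).card : ℝ) := by
    refine (Finset.sum_le_sum fun c hc => ?_).trans (Finset.sum_le_sum_of_subset_of_nonneg
      (Finset.subset_univ (Finset.univ.filter P)) fun c _ _ => by positivity)
    rw [← nsmul_one, ← Finset.sum_const]
    refine Finset.sum_le_sum fun S hS => ?_
    obtain ⟨S', hS', h⟩ := exists_subset_of_frag H (colorHistory c col m) S hS
    obtain ⟨x, hx, hxc⟩ := hP c (Finset.mem_filter.mp hc).2 S' hS'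
    have hxf : x ∈ frag H (colorHistory c col m) S := by
      rcases h x hx with h | ⟨W, hW, hxW⟩
      · exact h
      · obtain ⟨i, hi, rfl⟩ := (mem_colorHistory c col m W).mp hW
        simp only [colorClass, Finset.mem_filter] at hxW
        exact absurd hxW.2 (hxc i hi)
    exact_mod_cast Finset.card_pos.mpr ⟨x, hxf⟩
  rw [Finset.sum_const, nsmul_eq_mul] at h2
  refine le_of_mul_le_mul_right ((h2.trans h1).trans (le_of_eq ?_)) hpos
  ring

/-! ### Disjoint members of spread families -/

/-- Proportion of colourings with colours `ι × Fin (m + 1)` such that no member of a spread family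
is coloured with the first coordinate `a` throughout. -/
theorem card_group_missing_le {α ι : Type*} [Fintype α] [DecidableEq α] [Fintype ι] [DecidableEq ι]
    (m k : ℕ) (H : Finset (Finset α)) (κ : ℝ) (hκ0 : 0 < κ)
    (hκ : 32 * ((Fintype.card ι : ℝ) * (m + 1)) ≤ κ) (hH : IsSpreadOver κ ∅ H)
    (hk : ∀ S ∈ H, S.card ≤ k) (a : ι)
    [DecidablePred fun c : α → ι × Fin (m + 1) => ¬ ∃ S ∈ H, ∀ x ∈ S, (c x).1 = a] :
    ((Finset.univ.filter fun c : α → ι × Fin (m + 1) =>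
      ¬ ∃ S ∈ H, ∀ x ∈ S, (c x).1 = a).card : ℝ) ≤
      (5 / 8) ^ (m + 1) * k * (Fintype.card (α → ι × Fin (m + 1)) : ℝ) := by
  have h := card_colorings_missing_le H κ hκ0 (γ := ι × Fin (m + 1))
    (by simpa using hκ) hH k hk (fun i => (a, Fin.ofNat (m + 1) i)) (m + 1)
    (by
      intro i hi j hj hij
      have := congrArg (fun p => (Prod.snd p).val) hij
      simpa [Nat.mod_eq_of_lt (show i < m + 1 from hi),
        Nat.mod_eq_of_lt (show j < m + 1 from hj)] using this)
    (fun c => ¬ ∃ S ∈ H, ∀ x ∈ S, (c x).1 = a) (by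
      intro c hc S hS
      by_contra hcon
      push Not at hcon
      refine hc ⟨S, hS, fun x hx => ?_⟩
      obtain ⟨i, -, hi⟩ := hcon x hx
      rw [hi])
  refine h.trans (le_of_eq ?_)
  rw [Fintype.card_fun]
  push_cast
  rfl

/-- Give each family its own group of m+1 colours. A union bound over the s groups yields a
colouring in which every group contains a member of its family. -/
theorem exists_disjoint_system {α : Type*} [Fintype α] [DecidableEq α] (s m k : ℕ)
    (G : Fin s → Finset (Finset α)) (κ : ℝ) (hκ0 : 0 < κ)
    (hκ : 32 * ((s : ℝ) * (m + 1)) ≤ κ) (hG : ∀ i, IsSpreadOver κ ∅ (G i))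
    (hk : ∀ i, ∀ S ∈ G i, S.card ≤ k) (hm : (s : ℝ) * ((5 / 8) ^ (m + 1) * k) < 1) :
    ∃ B : Fin s → Finset α, (∀ i, B i ∈ G i) ∧ ∀ i j, i ≠ j → Disjoint (B i) (B j) := by
  classical
  rcases Nat.eq_zero_or_pos s with rfl | hs
  · exact ⟨fun i => i.elim0, fun i => i.elim0, fun i => i.elim0⟩
  have : NeZero s := ⟨hs.ne'⟩
  have hex : ∃ c : α → Fin s × Fin (m + 1), ∀ a, ∃ S ∈ G a, ∀ x ∈ S, (c x).1 = a := by
    by_contra hno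
    push Not at hno
    have hcov : (Finset.univ : Finset (α → Fin s × Fin (m + 1))) ⊆
        (Finset.univ : Finset (Fin s)).biUnion fun a => Finset.univ.filter fun c =>
          ¬ ∃ S ∈ G a, ∀ x ∈ S, (c x).1 = a := by
      intro c _
      obtain ⟨a, ha⟩ := hno c
      simp only [Finset.mem_biUnion, Finset.mem_univ, true_and, Finset.mem_filter]
      exact ⟨a, by push Not; exact ha⟩
    have h1 := (Finset.card_le_card hcov).trans Finset.card_biUnion_le
    rw [Finset.card_univ] at h1
    have h1' := (Nat.cast_le (α := ℝ)).mpr h1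
    rw [Nat.cast_sum] at h1'
    have h2 : (Fintype.card (α → Fin s × Fin (m + 1)) : ℝ) ≤
        ∑ a : Fin s, ((5 / 8) ^ (m + 1) * k * (Fintype.card (α → Fin s × Fin (m + 1)) : ℝ)) := by
      exact h1'.trans (Finset.sum_le_sum fun a _ => card_group_missing_le m k (G a) κ hκ0
        (by simpa using hκ) (hG a) (hk a) a)
    have hpos : (0 : ℝ) < Fintype.card (α → Fin s × Fin (m + 1)) := by
      exact_mod_cast Fintype.card_pos
    rw [Finset.sum_const, Finset.card_univ, Fintype.card_fin, nsmul_eq_mul, ← mul_assoc] at h2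
    have := mul_lt_mul_of_pos_right hm hpos
    linarith
  obtain ⟨c, hc⟩ := hex
  choose B hB hcB using hc
  refine ⟨B, hB, fun i j hij => Finset.disjoint_left.mpr fun x hx hx' => hij ?_⟩
  rw [← hcB i x hx, hcB j x hx']

/-- With a single family any s successful groups suffice. Using 2s groups, on average at most half
fail, so the union bound, and with it the dependence of m on s, is avoided. -/
theorem exists_disjoint_members {α : Type*} [Fintype α] [DecidableEq α] (s m k : ℕ)
    (H : Finset (Finset α)) (κ : ℝ) (hκ0 : 0 < κ) (hs : 0 < s)
    (hκ : 64 * ((s : ℝ) * (m + 1)) ≤ κ) (hH : IsSpreadOver κ ∅ H)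
    (hk : ∀ S ∈ H, S.card ≤ k) (hm : 2 * ((5 / 8 : ℝ) ^ (m + 1) * k) ≤ 1) :
    ∃ B : Fin s → Finset α, (∀ i, B i ∈ H) ∧ ∀ i j, i ≠ j → Disjoint (B i) (B j) := by
  classical
  have : NeZero (2 * s) := ⟨by omega⟩
  have hex : ∃ c : α → Fin (2 * s) × Fin (m + 1),
      ((Finset.univ.filter fun a => ¬ ∃ S ∈ H, ∀ x ∈ S, (c x).1 = a).card : ℝ) ≤ s := by
    have h : ∑ c : α → Fin (2 * s) × Fin (m + 1),
        ((Finset.univ.filter fun a => ¬ ∃ S ∈ H, ∀ x ∈ S, (c x).1 = a).card : ℝ) ≤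
        ∑ c : α → Fin (2 * s) × Fin (m + 1), (s : ℝ) := by
      calc _ = ∑ a : Fin (2 * s), ((Finset.univ.filter fun c : α → Fin (2 * s) × Fin (m + 1) =>
            ¬ ∃ S ∈ H, ∀ x ∈ S, (c x).1 = a).card : ℝ) := by
            simp only [Finset.card_filter, Nat.cast_sum]
            exact Finset.sum_comm
        _ ≤ ∑ a : Fin (2 * s), ((5 / 8) ^ (m + 1) * k *
            (Fintype.card (α → Fin (2 * s) × Fin (m + 1)) : ℝ)) :=
            Finset.sum_le_sum fun a _ => card_group_missing_le m k H κ hκ0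
              (by rw [Fintype.card_fin]; push_cast; linarith) hH hk a
        _ ≤ ∑ a : Fin (2 * s), (1 / 2 *
            (Fintype.card (α → Fin (2 * s) × Fin (m + 1)) : ℝ)) := by
            gcongr
            linarith
        _ = _ := by
            rw [Finset.sum_const, Finset.sum_const, Finset.card_univ, Finset.card_univ,
              Fintype.card_fin, nsmul_eq_mul, nsmul_eq_mul]
            push_cast
            ring
    obtain ⟨c, -, hc⟩ := Finset.exists_le_of_sum_le Finset.univ_nonempty h
    exact ⟨c, hc⟩
  obtain ⟨c, hc⟩ := hex
  have hc' : s ≤ (Finset.univ.filter fun a : Fin (2 * s) =>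
      ∃ S ∈ H, ∀ x ∈ S, (c x).1 = a).card := by
    have h1 := Finset.card_filter_add_card_filter_not (s := (Finset.univ : Finset (Fin (2 * s))))
      (fun a => ∃ S ∈ H, ∀ x ∈ S, (c x).1 = a)
    rw [Finset.card_univ, Fintype.card_fin] at h1
    have h2 : (Finset.univ.filter fun a => ¬ ∃ S ∈ H, ∀ x ∈ S, (c x).1 = a).card ≤ s := by
      exact_mod_cast hc
    omega
  obtain ⟨I, hI, hIs⟩ := Finset.exists_subset_card_eq hc'
  have hmem : ∀ i : Fin s, ∃ S ∈ H, ∀ x ∈ S, (c x).1 = I.orderEmbOfFin hIs i := by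
    intro i
    exact (Finset.mem_filter.mp (hI (Finset.orderEmbOfFin_mem I hIs i))).2
  choose B hB hcB using hmem
  refine ⟨B, hB, fun i j hij => Finset.disjoint_left.mpr fun x hx hx' => hij ?_⟩
  exact (I.orderEmbOfFin hIs).injective (by rw [← hcB i x hx, hcB j x hx'])

/-! ### Sunflowers as indexed systems -/

/-- Finitely many sets with pairwise intersection `C`, larger than `C`, form a sunflower. -/
theorem containsSunflowerCoreLE_of_system {α : Type*} [DecidableEq α] (s c : ℕ) (hs : 2 ≤ s)
    (F : Finset (Finset α)) (A : Fin s → Finset α) (C : Finset α) (hA : ∀ i, A i ∈ F)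
    (hC : ∀ i j, i ≠ j → A i ∩ A j = C) (hcard : ∀ i, C.card < (A i).card) (hCc : C.card ≤ c) :
    ContainsSunflowerCoreLE s c F := by
  have hinj : Function.Injective A := by
    intro i j hij
    by_contra hne
    have h := hC i j hne
    rw [hij, Finset.inter_self] at h
    have := hcard j
    rw [h] at this
    exact lt_irrefl _ this
  refine ⟨Finset.univ.image A, ?_, C, ⟨?_, ?_, ?_⟩, hCc⟩
  · intro X hX
    obtain ⟨i, -, rfl⟩ := Finset.mem_image.mp hX
    exact hA i
  · rw [Finset.card_image_of_injective _ hinj, Finset.card_univ, Fintype.card_fin]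
  · intro x
    constructor
    · intro hx X hX
      obtain ⟨i, -, rfl⟩ := Finset.mem_image.mp hX
      obtain ⟨j, hj⟩ : ∃ j : Fin s, i ≠ j := by
        have : Nontrivial (Fin s) := Fin.nontrivial_iff_two_le.mpr hs
        obtain ⟨j, hj⟩ := exists_ne i
        exact ⟨j, hj.symm⟩
      rw [← hC i j hj] at hx
      exact Finset.mem_of_mem_inter_left hx
    · intro h
      have h01 : (⟨0, by omega⟩ : Fin s) ≠ ⟨1, by omega⟩ := by simp
      rw [← hC _ _ h01]
      exact Finset.mem_inter.mpr ⟨h _ (Finset.mem_image_of_mem _ (Finset.mem_univ _)),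
        h _ (Finset.mem_image_of_mem _ (Finset.mem_univ _))⟩
  · intro X hX Y hY hXY
    obtain ⟨i, -, rfl⟩ := Finset.mem_image.mp hX
    obtain ⟨j, -, rfl⟩ := Finset.mem_image.mp hY
    exact hC i j fun h => hXY (by rw [h])

theorem exists_system_of_isSunflower {α : Type*} [DecidableEq α] {s : ℕ} {S : Finset (Finset α)}
    {C : Finset α} (h : IsSunflower s S C) :
    ∃ A : Fin s → Finset α, Function.Injective A ∧ (∀ i, A i ∈ S) ∧
      ∀ i j, i ≠ j → A i ∩ A j = C := by
  obtain ⟨hcard, -, hpair⟩ := h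
  let e := S.equivFinOfCardEq hcard
  refine ⟨fun i => (e.symm i : Finset α), fun i j hij => e.symm.injective (Subtype.ext hij),
    fun i => (e.symm i).2, fun i j hij => hpair _ (e.symm i).2 _ (e.symm j).2 fun h => hij ?_⟩
  exact e.symm.injective (Subtype.ext h)

/-! ### Spread restrictions and their links -/

/-- Take X of largest size with the stated density: a proper superset violating spreadness over X
would have that density as well. -/
theorem exists_isSpreadOver_filter {α : Type*} [Fintype α] [DecidableEq α] (r : ℝ) (hr : 0 < r)
    (H : Finset (Finset α)) (hH : H.Nonempty) :
    ∃ X, (H.card : ℝ) ≤ r ^ X.card * (H.filter fun A => X ⊆ A).card ∧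
      IsSpreadOver r X (H.filter fun A => X ⊆ A) := by
  classical
  obtain ⟨X, hX, hmax⟩ := Finset.exists_max_image
    ((Finset.univ : Finset (Finset α)).filter fun X =>
      (H.card : ℝ) ≤ r ^ X.card * (H.filter fun A => X ⊆ A).card) Finset.card ⟨∅, by simp⟩
  simp only [Finset.mem_filter, Finset.mem_univ, true_and] at hX hmax
  have hpos : (0 : ℝ) < H.card := by exact_mod_cast hH.card_pos
  refine ⟨X, hX, ?_, fun A hA => (Finset.mem_filter.mp hA).2, ?_⟩
  · rw [← Finset.card_pos]
    by_contra h
    have h0 : (H.filter fun A => X ⊆ A).card = 0 := by omega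
    rw [h0, Nat.cast_zero, mul_zero] at hX
    linarith
  · intro Y hXY
    rcases eq_or_ne X Y with rfl | hne
    · simp only [Finset.sdiff_self, Finset.card_empty, pow_zero, one_mul]
      exact_mod_cast Finset.card_filter_le _ _
    · have hlt : X.card < Y.card := Finset.card_lt_card (hXY.ssubset_of_ne hne)
      have hY : r ^ Y.card * (H.filter fun A => Y ⊆ A).card < H.card := by
        by_contra h
        exact absurd (hmax Y (not_lt.mp h)) (by omega)
      have hle : (((H.filter fun A => X ⊆ A).filter fun A => Y ⊆ A).card : ℝ) ≤
          (H.filter fun A => Y ⊆ A).card := by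
        exact_mod_cast Finset.card_le_card
          (Finset.filter_subset_filter _ (Finset.filter_subset _ _))
      have hexp : r ^ Y.card = r ^ X.card * r ^ (Y \ X).card := by
        rw [← pow_add, Finset.card_sdiff_of_subset hXY]
        congr 1
        omega
      have hrX : 0 < r ^ X.card := by positivity
      refine le_of_mul_le_mul_left ?_ hrX
      calc _ ≤ r ^ X.card * (r ^ (Y \ X).card * (H.filter fun A => Y ⊆ A).card) := by gcongr
        _ = r ^ Y.card * (H.filter fun A => Y ⊆ A).card := by rw [hexp]; ring
        _ ≤ _ := hY.le.trans hX

/-- Each point of U outside X lies in at most a 1/κ share of G, so at least half of G avoids U \ X.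
The lost factor 2 is at most 2^|Y| for nonempty Y, which is why κ is halved. -/
theorem isSpreadOver_link {α : Type*} [DecidableEq α] (κ : ℝ) (hκ0 : 0 < κ) (X U : Finset α)
    (G : Finset (Finset α)) (hG : IsSpreadOver κ X G) (hU : 2 * (U.card : ℝ) ≤ κ) :
    IsSpreadOver (κ / 2) ∅ ((G.filter fun A => Disjoint (A \ X) U).image fun A => A \ X) := by
  classical
  obtain ⟨hne, hX, hspread⟩ := hG
  have hGpos : (0 : ℝ) < G.card := by exact_mod_cast hne.card_pos
  have hinj : Set.InjOn (fun A => A \ X) (G : Set (Finset α)) := by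
    intro A hA B hB hAB
    rw [← Finset.sdiff_union_of_subset (hX A hA), ← Finset.sdiff_union_of_subset (hX B hB)]
    exact congrArg (· ∪ X) hAB
  set G' := G.filter fun A => Disjoint (A \ X) U with hG'
  have hcard : (G'.image fun A => A \ X).card = G'.card :=
    Finset.card_image_of_injOn (hinj.mono (Finset.coe_subset.mpr (Finset.filter_subset _ _)))
  have hhit : ((G.filter fun A => ¬ Disjoint (A \ X) U).card : ℝ) ≤ G.card / 2 := by
    have hcov : (G.filter fun A => ¬ Disjoint (A \ X) U) ⊆
        (U \ X).biUnion fun u => G.filter fun A => insert u X ⊆ A := by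
      intro A hA
      rw [Finset.mem_filter, Finset.not_disjoint_iff] at hA
      obtain ⟨hAG, u, huA, huU⟩ := hA
      rw [Finset.mem_sdiff] at huA
      exact Finset.mem_biUnion.mpr ⟨u, Finset.mem_sdiff.mpr ⟨huU, huA.2⟩,
        Finset.mem_filter.mpr ⟨hAG, Finset.insert_subset huA.1 (hX A hAG)⟩⟩
    have hone : ∀ u ∈ U \ X, ((G.filter fun A => insert u X ⊆ A).card : ℝ) ≤ G.card / κ := by
      intro u hu
      have hu' := (Finset.mem_sdiff.mp hu).2
      have h := hspread (insert u X) (Finset.subset_insert _ _)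
      rw [Finset.insert_sdiff_of_notMem _ hu', Finset.sdiff_self] at h
      simp only [insert_empty_eq, Finset.card_singleton, pow_one] at h
      rw [le_div_iff₀ hκ0]
      linarith
    have h1 : ((G.filter fun A => ¬ Disjoint (A \ X) U).card : ℝ) ≤
        ∑ u ∈ U \ X, ((G.filter fun A => insert u X ⊆ A).card : ℝ) := by
      exact_mod_cast (Finset.card_le_card hcov).trans Finset.card_biUnion_le
    have h2 := Finset.sum_le_card_nsmul _ _ _ hone
    rw [nsmul_eq_mul] at h2
    have h3 : ((U \ X).card : ℝ) ≤ U.card := by exact_mod_cast Finset.card_le_card Finset.sdiff_subset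
    calc _ ≤ _ := h1.trans h2
      _ ≤ κ / 2 * (G.card / κ) := by gcongr; linarith
      _ = G.card / 2 := by field_simp
  have hhalf : (G.card : ℝ) ≤ 2 * G'.card := by
    have := Finset.card_filter_add_card_filter_not (s := G) (fun A => Disjoint (A \ X) U)
    have h' : (G'.card : ℝ) + (G.filter fun A => ¬ Disjoint (A \ X) U).card = G.card := by
      exact_mod_cast this
    linarith
  refine ⟨?_, fun A _ => Finset.empty_subset A, ?_⟩
  · rw [← Finset.card_pos, hcard]
    have : (0 : ℝ) < G'.card := by linarith
    exact_mod_cast this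
  · intro Y _
    rw [Finset.sdiff_empty, hcard]
    rcases Finset.eq_empty_or_nonempty Y with rfl | hY
    · simp [hcard]
    by_cases hYX : Disjoint Y X
    · have h1 : (((G'.image fun A => A \ X).filter fun A => Y ⊆ A).card : ℝ) ≤
          (G.filter fun A => X ∪ Y ⊆ A).card := by
        have : ((G'.image fun A => A \ X).filter fun A => Y ⊆ A) ⊆
            (G.filter fun A => X ∪ Y ⊆ A).image fun A => A \ X := by
          intro B hB
          rw [Finset.mem_filter, Finset.mem_image] at hB
          obtain ⟨⟨A, hA, rfl⟩, hYA⟩ := hB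
          have hAG := (Finset.mem_filter.mp hA).1
          exact Finset.mem_image.mpr ⟨A, Finset.mem_filter.mpr
            ⟨hAG, Finset.union_subset (hX A hAG) (hYA.trans Finset.sdiff_subset)⟩, rfl⟩
        exact_mod_cast (Finset.card_le_card this).trans Finset.card_image_le
      have h2 := hspread (X ∪ Y) Finset.subset_union_left
      rw [Finset.union_sdiff_cancel_left hYX.symm] at h2
      have hp : (2 : ℝ) ≤ 2 ^ Y.card := by
        calc (2 : ℝ) = 2 ^ 1 := by norm_num
          _ ≤ _ := pow_le_pow_right₀ (by norm_num) hY.card_pos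
      rw [div_pow, div_mul_eq_mul_div, div_le_iff₀ (by positivity)]
      calc _ ≤ κ ^ Y.card * (G.filter fun A => X ∪ Y ⊆ A).card := by gcongr
        _ ≤ _ := h2
        _ ≤ G'.card * 2 := by linarith
        _ ≤ _ := by gcongr
    · have h0 : ((G'.image fun A => A \ X).filter fun A => Y ⊆ A) = ∅ := by
        refine Finset.filter_eq_empty_iff.mpr fun B hB hYB => hYX ?_
        obtain ⟨A, -, rfl⟩ := Finset.mem_image.mp hB
        exact Finset.disjoint_of_subset_left hYB Finset.sdiff_disjoint
      rw [h0]
      simp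

/-- A system of sets with pairwise intersection `C` over each of which `F` has a spread subfamily
extends to a sunflower in `F` with core `C`. -/
theorem containsSunflowerCoreLE_of_spread_system {α : Type*} [Fintype α] [DecidableEq α]
    (s c k q m : ℕ) (hs : 2 ≤ s) (F : Finset (Finset α)) (hF : ∀ A ∈ F, A.card = k) (r : ℝ)
    (hr0 : 0 < r) (hr1 : 2 * ((s : ℝ) * q) ≤ r) (hr2 : 64 * ((s : ℝ) * (m + 1)) ≤ r)
    (hm : (s : ℝ) * ((5 / 8) ^ (m + 1) * k) < 1) (S : Fin s → Finset α) (C : Finset α)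
    (hC : ∀ i j, i ≠ j → S i ∩ S j = C) (hCc : C.card ≤ c) (hck : c < k)
    (hSq : ∀ i, (S i).card ≤ q) (hS : ∀ i, ∃ G ⊆ F, IsSpreadOver r (S i) G) :
    ContainsSunflowerCoreLE s c F := by
  classical
  choose G hGF hG using hS
  set U := Finset.univ.biUnion S with hU
  have hUcard : U.card ≤ s * q := by
    have := Finset.card_biUnion_le_card_mul Finset.univ S q fun i _ => hSq i
    simpa using this
  have hUr : 2 * (U.card : ℝ) ≤ r := by
    have : (U.card : ℝ) ≤ s * q := by exact_mod_cast hUcard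
    linarith
  obtain ⟨B, hB, hdisj⟩ := exists_disjoint_system s m k
    (fun i => ((G i).filter fun A => Disjoint (A \ S i) U).image fun A => A \ S i) (r / 2)
    (by positivity) (by linarith) (fun i => isSpreadOver_link r hr0 (S i) U (G i) (hG i) hUr)
    (by
      intro i A hA
      obtain ⟨A', hA', rfl⟩ := Finset.mem_image.mp hA
      rw [← hF A' (hGF i (Finset.mem_filter.mp hA').1)]
      exact Finset.card_le_card Finset.sdiff_subset) hm
  have hA : ∀ i, ∃ A ∈ F, S i ⊆ A ∧ A \ S i = B i ∧ Disjoint (B i) U := by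
    intro i
    obtain ⟨A, hA, hAB⟩ := Finset.mem_image.mp (hB i)
    rw [Finset.mem_filter] at hA
    have hAB' : A \ S i = B i := hAB
    exact ⟨A, hGF i hA.1, (hG i).2.1 A hA.1, hAB', by rw [← hAB']; exact hA.2⟩
  choose A hAF hSA hAB hBU using hA
  have hSU : ∀ i, S i ⊆ U := fun i => Finset.subset_biUnion_of_mem S (Finset.mem_univ i)
  refine containsSunflowerCoreLE_of_system s c hs F A C hAF (fun i j hij => ?_)
    (fun i => by rw [hF _ (hAF i)]; omega) hCc
  rw [← hC i j hij]
  ext x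
  have key : ∀ i, x ∈ A i → x ∉ S i → x ∈ B i := fun i h1 h2 => by
    rw [← hAB i]; exact Finset.mem_sdiff.mpr ⟨h1, h2⟩
  have hno : ∀ i j, x ∈ B i → x ∉ S j := fun i j h1 h2 =>
    Finset.disjoint_left.mp (hBU i) h1 (hSU j h2)
  simp only [Finset.mem_inter]
  constructor
  · rintro ⟨hi, hj⟩
    by_cases hxi : x ∈ S i
    · refine ⟨hxi, ?_⟩
      by_contra hxj
      exact hno j i (key j hj hxj) hxi
    · exfalso
      have hBi := key i hi hxi
      have hxj : x ∉ S j := hno i j hBi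
      exact Finset.disjoint_left.mp (hdisj i j hij) hBi (key j hj hxj)
  · rintro ⟨hi, hj⟩
    exact ⟨hSA i hi, hSA j hj⟩

/-! ### Spread approximation and its reduction -/

/-- `T` consists of sets with sizes in `[t, q]`, has no sunflower with `s` petals and core of size
at most `t - 1`, and every member of `F` contains a member of `T`. -/
def IsApproximation {α : Type*} [DecidableEq α] (s t q : ℕ) (F T : Finset (Finset α)) : Prop :=
  (∀ X ∈ T, t ≤ X.card ∧ X.card ≤ q) ∧ ¬ ContainsSunflowerCoreLE s (t - 1) T ∧
    ∀ A ∈ F, ∃ X ∈ T, X ⊆ A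

/-- T consists of all sets of size at most q over which F has an r-spread subfamily, and F' of the
sets of F above none of them. A spread restriction of F' lives over some X; were |X| ≤ q, X would be
in T. -/
theorem exists_isApproximation {α : Type*} [Fintype α] [DecidableEq α]
    (s t k q m : ℕ) (hs : 2 ≤ s) (ht : 1 ≤ t) (htk : t ≤ k) (F : Finset (Finset α))
    (hF : ∀ A ∈ F, A.card = k) (r : ℝ)
    (hr0 : 0 < r) (hr1 : 2 * ((s : ℝ) * q) ≤ r) (hr2 : 64 * ((s : ℝ) * (m + 1)) ≤ r)
    (hm : (s : ℝ) * ((5 / 8) ^ (m + 1) * k) < 1) (hfree : ¬ ContainsSunflowerCoreLE s (t - 1) F) :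
    ∃ F' ⊆ F, ∃ T, IsApproximation s t q (F \ F') T ∧
      (F'.Nonempty → ∃ X : Finset α, q < X.card ∧
        (F'.card : ℝ) ≤ r ^ X.card * (F.filter fun A => X ⊆ A).card) := by
  classical
  set T := (Finset.univ : Finset (Finset α)).filter fun X =>
    X.card ≤ q ∧ ∃ G ⊆ F, IsSpreadOver r X G with hT
  have hTmem : ∀ X, X ∈ T ↔ X.card ≤ q ∧ ∃ G ⊆ F, IsSpreadOver r X G := by
    intro X; simp [hT]
  -- Repetitions among the S i are allowed; the constant system later gives |X| ≥ t for X in T.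
  have hsys : ∀ S : Fin s → Finset α, ∀ C, (∀ i, S i ∈ T) → (∀ i j, i ≠ j → S i ∩ S j = C) →
      t ≤ C.card := by
    intro S C hS hC
    by_contra hlt
    exact hfree (containsSunflowerCoreLE_of_spread_system s (t - 1) k q m hs F hF r hr0 hr1 hr2 hm
      S C hC (by omega) (by omega) (fun i => ((hTmem _).mp (hS i)).1)
      fun i => ((hTmem _).mp (hS i)).2)
  refine ⟨F.filter fun A => ∀ X ∈ T, ¬ X ⊆ A, Finset.filter_subset _ _, T, ⟨?_, ?_, ?_⟩, ?_⟩
  · intro X hX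
    exact ⟨hsys (fun _ => X) X (fun _ => hX) fun i j _ => Finset.inter_self X,
      ((hTmem X).mp hX).1⟩
  · rintro ⟨S, hST, C, hS, hCc⟩
    obtain ⟨A, -, hA, hAC⟩ := exists_system_of_isSunflower hS
    have := hsys A C (fun i => hST (hA i)) hAC
    omega
  · intro A hA
    rw [Finset.mem_sdiff, Finset.mem_filter] at hA
    by_contra h
    exact hA.2 ⟨hA.1, fun X hX hXA => h ⟨X, hX, hXA⟩⟩
  · intro hne
    obtain ⟨X, hX, hspread⟩ := exists_isSpreadOver_filter r hr0 _ hne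
    refine ⟨X, ?_, hX.trans ?_⟩
    · by_contra hq
      have hXT : X ∈ T := (hTmem X).mpr ⟨not_lt.mp hq, _,
        (Finset.filter_subset _ _).trans (Finset.filter_subset _ _), hspread⟩
      obtain ⟨A, hA⟩ := hspread.1
      rw [Finset.mem_filter, Finset.mem_filter] at hA
      exact hA.1.2 X hXT hA.2
    · gcongr
      exact Finset.filter_subset _ _

/-- Take an approximation with fewest members. If some Y lies in too many i-sets, choose Y largest
and replace all those sets by Y alone. This is again an approximation, with fewer members. -/
theorem exists_reduced_approximation {α : Type*} [DecidableEq α] (s t q D : ℕ)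
    (hs : 2 ≤ s) (ht : 1 ≤ t) (F : Finset (Finset α)) (hD : s * q < D)
    (hex : ∃ T, IsApproximation s t q F T) :
    ∃ T, IsApproximation s t q F T ∧ ∀ i Y, t ≤ Y.card → Y.card ≤ i →
      (T.filter fun A => A.card = i ∧ Y ⊆ A).card ≤ D ^ (i - Y.card) := by
  classical
  obtain ⟨T, hT, hmin⟩ : ∃ T, IsApproximation s t q F T ∧
      ∀ T', IsApproximation s t q F T' → T.card ≤ T'.card := by
    have hex' : ∃ c, ∃ T, IsApproximation s t q F T ∧ T.card = c := by
      obtain ⟨T, hT⟩ := hex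
      exact ⟨_, T, hT, rfl⟩
    obtain ⟨T, hT, hc⟩ := Nat.find_spec hex'
    exact ⟨T, hT, fun T' hT' => by rw [hc]; exact Nat.find_min' hex' ⟨T', hT', rfl⟩⟩
  refine ⟨T, hT, ?_⟩
  intro i Y₀ hY₀t hY₀i
  by_contra hviol
  -- a largest violating set; it is smaller than `i`, hence contained in the union of `T`
  have hbound : ∀ Y : Finset α, Y ∈ (T.biUnion Finset.powerset).filter (fun Y => t ≤ Y.card ∧
      Y.card ≤ i ∧ D ^ (i - Y.card) < (T.filter fun A => A.card = i ∧ Y ⊆ A).card) ↔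
      (t ≤ Y.card ∧ Y.card ≤ i ∧
        D ^ (i - Y.card) < (T.filter fun A => A.card = i ∧ Y ⊆ A).card) := by
    intro Y
    rw [Finset.mem_filter, and_iff_right_iff_imp]
    rintro ⟨-, -, h⟩
    obtain ⟨A, hA⟩ := Finset.card_pos.mp (lt_of_le_of_lt (Nat.zero_le _) h)
    rw [Finset.mem_filter] at hA
    exact Finset.mem_biUnion.mpr ⟨A, hA.1, Finset.mem_powerset.mpr hA.2.2⟩
  obtain ⟨Y, hY, hmax⟩ := Finset.exists_max_image _ Finset.card
    ⟨Y₀, (hbound Y₀).mpr ⟨hY₀t, hY₀i, not_le.mp hviol⟩⟩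
  obtain ⟨hYt, hYi, hYD⟩ := (hbound Y).mp hY
  set W := T.filter fun A => A.card = i ∧ Y ⊆ A with hW
  have hYlt : Y.card < i := by
    rcases hYi.lt_or_eq with h | h
    · exact h
    · exfalso
      have : W ⊆ {Y} := by
        intro A hA
        rw [hW, Finset.mem_filter] at hA
        exact Finset.mem_singleton.mpr
          (Finset.eq_of_subset_of_card_le hA.2.2 (by omega)).symm
      have h1 := Finset.card_le_card this
      rw [h, Nat.sub_self, pow_zero] at hYD
      rw [Finset.card_singleton] at h1
      omega
  have hsucc : ∀ u, u ∉ Y → (T.filter fun A => A.card = i ∧ insert u Y ⊆ A).card ≤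
      D ^ (i - Y.card - 1) := by
    intro u hu
    by_contra h
    have hc : (insert u Y).card = Y.card + 1 := Finset.card_insert_of_notMem hu
    have := hmax (insert u Y) ((hbound _).mpr ⟨by omega, by omega, by
      rw [hc, Nat.sub_add_eq]; exact not_le.mp h⟩)
    omega
  have hWT : W ⊆ T := Finset.filter_subset _ _
  have hD1 : 1 ≤ D := by omega
  have hW2 : 1 < W.card := lt_of_le_of_lt (Nat.one_le_pow _ _ hD1) hYD
  have hWne : W.Nonempty := Finset.card_pos.mp (by omega)
  have hiq : i ≤ q := by
    obtain ⟨A, hA⟩ := hWne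
    rw [hW, Finset.mem_filter] at hA
    rw [← hA.2.1]
    exact (hT.1 A hA.1).2
  have hnew : IsApproximation s t q F (insert Y (T \ W)) := by
    refine ⟨?_, ?_, ?_⟩
    · intro X hX
      rcases Finset.mem_insert.mp hX with rfl | hX
      · exact ⟨hYt, by omega⟩
      · exact hT.1 X (Finset.mem_sdiff.mp hX).1
    · rintro ⟨S, hST, C, hS, hCc⟩
      obtain ⟨A, hAinj, hA, hAC⟩ := exists_system_of_isSunflower hS
      have hAT : ∀ j, A j ≠ Y → A j ∈ T := by
        intro j hj
        rcases Finset.mem_insert.mp (hST (hA j)) with h | h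
        · exact absurd h hj
        · exact (Finset.mem_sdiff.mp h).1
      by_cases hYA : ∃ j, A j = Y
      · obtain ⟨j₀, hj₀⟩ := hYA
        have hne : ∀ j, j ≠ j₀ → A j ≠ Y := fun j hj h => hj (hAinj (h.trans hj₀.symm))
        set U := Finset.univ.biUnion A \ Y with hU
        have hUcard : U.card ≤ s * q := by
          have h := Finset.card_biUnion_le_card_mul Finset.univ A q (by
            intro j _
            by_cases hj : A j = Y
            · rw [hj]; omega
            · exact (hT.1 _ (hAT j hj)).2)
          rw [Finset.card_univ, Fintype.card_fin] at h
          exact (Finset.card_le_card Finset.sdiff_subset).trans h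
        -- To turn a sunflower through Y into one in T, Y is replaced by a Z in W that avoids the
        -- other petals outside Y. By maximality of Y each point of U spoils at most D^{i-|Y|-1}
        -- sets, and |U| ≤ sq < D, so some Z survives.
        obtain ⟨Z, hZW, hZU⟩ : ∃ Z ∈ W, ∀ u ∈ U, u ∉ Z := by
          by_contra hno
          push Not at hno
          have hcov : W ⊆ U.biUnion fun u => T.filter fun A => A.card = i ∧ insert u Y ⊆ A := by
            intro Z hZ
            obtain ⟨u, hu, huZ⟩ := hno Z hZ
            rw [hW, Finset.mem_filter] at hZ
            exact Finset.mem_biUnion.mpr ⟨u, hu, Finset.mem_filter.mpr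
              ⟨hZ.1, hZ.2.1, Finset.insert_subset huZ hZ.2.2⟩⟩
          have h1 := (Finset.card_le_card hcov).trans (Finset.card_biUnion_le_card_mul _ _ _
            fun u hu => hsucc u (Finset.mem_sdiff.mp hu).2)
          have h2 : U.card * D ^ (i - Y.card - 1) ≤ D * D ^ (i - Y.card - 1) :=
            Nat.mul_le_mul_right _ (by omega)
          rw [← pow_succ', Nat.sub_add_cancel (by omega : 1 ≤ i - Y.card)] at h2
          omega
        rw [hW, Finset.mem_filter] at hZW
        have hZA : ∀ j, j ≠ j₀ → A j ∩ Z = C := by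
          intro j hj
          rw [← hAC j j₀ hj, hj₀]
          ext x
          simp only [Finset.mem_inter]
          refine ⟨fun ⟨h1, h2⟩ => ⟨h1, ?_⟩, fun ⟨h1, h2⟩ => ⟨h1, hZW.2.2 h2⟩⟩
          by_contra hxY
          exact hZU x (Finset.mem_sdiff.mpr ⟨Finset.mem_biUnion.mpr
            ⟨j, Finset.mem_univ j, h1⟩, hxY⟩) h2
        have hmemT : ∀ j, Function.update A j₀ Z j ∈ T := by
          intro j
          by_cases hj : j = j₀
          · subst hj; simpa using hZW.1
          · simpa [hj] using hAT j (hne j hj)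
        refine hT.2.1 (containsSunflowerCoreLE_of_system s (t - 1) hs T (Function.update A j₀ Z) C
          hmemT ?_ (fun j => ?_) hCc)
        · intro j l hjl
          by_cases hj : j = j₀
          · subst hj
            rw [Function.update_self, Function.update_of_ne hjl.symm, Finset.inter_comm]
            exact hZA l hjl.symm
          · rw [Function.update_of_ne hj]
            by_cases hl : l = j₀
            · subst hl
              rw [Function.update_self]
              exact hZA j hj
            · rw [Function.update_of_ne hl]
              exact hAC j l hjl
        · have := (hT.1 _ (hmemT j)).1
          omega
      · push Not at hYA
        refine hT.2.1 (containsSunflowerCoreLE_of_system s (t - 1) hs T A C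
          (fun j => hAT j (hYA j)) hAC (fun j => ?_) hCc)
        have := (hT.1 _ (hAT j (hYA j))).1
        omega
    · intro A hA
      obtain ⟨X, hX, hXA⟩ := hT.2.2 A hA
      by_cases hXW : X ∈ W
      · rw [hW, Finset.mem_filter] at hXW
        exact ⟨Y, Finset.mem_insert_self _ _, hXW.2.2.trans hXA⟩
      · exact ⟨X, Finset.mem_insert_of_mem (Finset.mem_sdiff.mpr ⟨hX, hXW⟩), hXA⟩
  have h1 := hmin _ hnew
  have h2 := Finset.card_insert_le Y (T \ W)
  have h3 := Finset.card_sdiff_add_card_eq_card hWT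
  omega

/-! ### Size of the layers of a reduced approximation -/

/-- Otherwise take a largest X, |X| ≤ t, whose degree in the layer exceeds R^{t-|X|} D^{i-t}; the
degree bound forces |X| < t. The layer over X is R-spread: by maximality against Y of size at most
t, by the degree bound and R ≤ D against larger Y. Disjoint members of the link then give a
sunflower with core X. -/
theorem card_layer_le {α : Type*} [Fintype α] [DecidableEq α] (s t i m D : ℕ) (R : ℝ)
    (hs : 2 ≤ s) (ht : 1 ≤ t) (hti : t < i) (T : Finset (Finset α))
    (hfree : ¬ ContainsSunflowerCoreLE s (t - 1) T)
    (hT : ∀ Y, t ≤ Y.card → Y.card ≤ i →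
      (T.filter fun A => A.card = i ∧ Y ⊆ A).card ≤ D ^ (i - Y.card))
    (hR0 : 0 < R) (hRD : R ≤ D) (hR : 128 * ((s : ℝ) * (m + 1)) ≤ R)
    (hm : 2 * ((5 / 8 : ℝ) ^ (m + 1) * i) ≤ 1) :
    ((T.filter fun A => A.card = i).card : ℝ) ≤ R ^ t * (D : ℝ) ^ (i - t) := by
  classical
  by_contra hviol
  have hD0 : (0 : ℝ) < D := hR0.trans_le hRD
  obtain ⟨X, hX, hmax⟩ := Finset.exists_max_image
    ((Finset.univ : Finset (Finset α)).filter fun X => X.card ≤ t ∧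
      R ^ (t - X.card) * (D : ℝ) ^ (i - t) < (T.filter fun A => A.card = i ∧ X ⊆ A).card)
    Finset.card ⟨∅, by simpa using hviol⟩
  simp only [Finset.mem_filter, Finset.mem_univ, true_and] at hX hmax
  obtain ⟨hXt, hXbig⟩ := hX
  have hTr : ∀ Y : Finset α, t ≤ Y.card → Y.card ≤ i →
      ((T.filter fun A => A.card = i ∧ Y ⊆ A).card : ℝ) ≤ (D : ℝ) ^ (i - Y.card) := by
    intro Y h1 h2
    exact_mod_cast hT Y h1 h2
  have hXlt : X.card < t := by
    rcases hXt.lt_or_eq with h | h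
    · exact h
    · have := hTr X h.ge (by omega)
      rw [h] at this hXbig
      rw [Nat.sub_self, pow_zero, one_mul] at hXbig
      linarith
  set W := T.filter fun A => A.card = i ∧ X ⊆ A with hW
  have hWY : ∀ Y, ((W.filter fun A => Y ⊆ A).card : ℝ) ≤
      (T.filter fun A => A.card = i ∧ Y ⊆ A).card := by
    intro Y
    refine Nat.cast_le.mpr (Finset.card_le_card fun A hA => ?_)
    simp only [hW, Finset.mem_filter] at hA ⊢
    exact ⟨hA.1.1, hA.1.2.1, hA.2⟩
  have hspread : IsSpreadOver R X W := by
    refine ⟨?_, fun A hA => (Finset.mem_filter.mp hA).2.2, fun Y hXY => ?_⟩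
    · rw [← Finset.card_pos]
      have : (0 : ℝ) < W.card := lt_of_le_of_lt (by positivity) hXbig
      exact_mod_cast this
    rcases eq_or_ne X Y with rfl | hne
    · simp only [Finset.sdiff_self, Finset.card_empty, pow_zero, one_mul]
      exact_mod_cast Finset.card_filter_le _ _
    have hlt : X.card < Y.card := Finset.card_lt_card (hXY.ssubset_of_ne hne)
    rw [Finset.card_sdiff_of_subset hXY]
    rcases le_or_gt Y.card t with hYt | hYt
    · have hY : ((T.filter fun A => A.card = i ∧ Y ⊆ A).card : ℝ) ≤
          R ^ (t - Y.card) * (D : ℝ) ^ (i - t) := by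
        by_contra h
        exact absurd (hmax Y ⟨hYt, not_le.mp h⟩) (by omega)
      calc _ ≤ R ^ (Y.card - X.card) * (R ^ (t - Y.card) * (D : ℝ) ^ (i - t)) := by
            gcongr
            exact (hWY Y).trans hY
        _ = R ^ (t - X.card) * (D : ℝ) ^ (i - t) := by
            rw [← mul_assoc, ← pow_add]
            congr 3
            omega
        _ ≤ _ := hXbig.le
    · rcases le_or_gt Y.card i with hYi | hYi
      · calc _ ≤ R ^ (Y.card - X.card) * (D : ℝ) ^ (i - Y.card) := by
              gcongr
              exact (hWY Y).trans (hTr Y hYt.le hYi)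
          _ = R ^ (t - X.card) * (R ^ (Y.card - t) * (D : ℝ) ^ (i - Y.card)) := by
              rw [← mul_assoc, ← pow_add]
              congr 2
              omega
          _ ≤ R ^ (t - X.card) * ((D : ℝ) ^ (Y.card - t) * (D : ℝ) ^ (i - Y.card)) := by
              gcongr
          _ = R ^ (t - X.card) * (D : ℝ) ^ (i - t) := by
              rw [← pow_add]
              congr 2
              omega
          _ ≤ _ := hXbig.le
      · have h0 : W.filter (fun A => Y ⊆ A) = ∅ := by
          refine Finset.filter_eq_empty_iff.mpr fun A hA hYA => ?_
          have h1 := Finset.card_le_card hYA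
          rw [(Finset.mem_filter.mp hA).2.1] at h1
          omega
        rw [h0]
        simp
  -- Nothing has to be avoided here, so the link is taken with U = ∅.
  obtain ⟨B, hB, hdisj⟩ := exists_disjoint_members s m i
    ((W.filter fun A => Disjoint (A \ X) ∅).image fun A => A \ X) (R / 2) (by positivity)
    (by omega) (by linarith) (isSpreadOver_link R hR0 X ∅ W hspread (by simpa using hR0.le)) (by
      intro A hA
      obtain ⟨A', hA', rfl⟩ := Finset.mem_image.mp hA
      rw [← (Finset.mem_filter.mp (Finset.mem_filter.mp hA').1).2.1]
      exact Finset.card_le_card Finset.sdiff_subset) hm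
  have hA : ∀ j, ∃ A ∈ W, A \ X = B j := by
    intro j
    obtain ⟨A, hA, hAB⟩ := Finset.mem_image.mp (hB j)
    exact ⟨A, (Finset.mem_filter.mp hA).1, hAB⟩
  choose A hAW hAB using hA
  have hAW' : ∀ j, A j ∈ T ∧ (A j).card = i ∧ X ⊆ A j := fun j => Finset.mem_filter.mp (hAW j)
  refine hfree (containsSunflowerCoreLE_of_system s (t - 1) hs T A X (fun j => (hAW' j).1)
    (fun j l hjl => ?_) (fun j => by rw [(hAW' j).2.1]; omega) (by omega))
  ext x
  rw [Finset.mem_inter]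
  refine ⟨fun ⟨h1, h2⟩ => ?_, fun h => ⟨(hAW' j).2.2 h, (hAW' l).2.2 h⟩⟩
  by_contra hx
  have h3 : x ∈ B j := by rw [← hAB j]; exact Finset.mem_sdiff.mpr ⟨h1, hx⟩
  have h4 : x ∈ B l := by rw [← hAB l]; exact Finset.mem_sdiff.mpr ⟨h2, hx⟩
  exact Finset.disjoint_left.mp (hdisj j l hjl) h3 h4

/-! ### Comparison with φ(s,t) and counting supersets -/

theorem card_inter_lt_of_ne {α : Type*} [DecidableEq α] {t : ℕ} {A B : Finset α}
    (hA : A.card = t) (hB : B.card = t) (hne : A ≠ B) : (A ∩ B).card < t := by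
  by_contra hge
  rw [not_lt] at hge
  exact hne ((Finset.eq_of_subset_of_card_le Finset.inter_subset_left (by rw [hA]; exact hge)).symm.trans
    (Finset.eq_of_subset_of_card_le Finset.inter_subset_right (by rw [hB]; exact hge)))

/-- Distinct t-sets meet in fewer than t points, so in a t-uniform family the restriction on the
core excludes nothing. -/
theorem card_le_sunflowerPhi {n : ℕ} (s t : ℕ) (hs : 2 ≤ s) (T : Finset (Finset (Fin n)))
    (hT : ∀ A ∈ T, A.card = t) (hfree : ¬ ContainsSunflowerCoreLE s (t - 1) T) :
    T.card ≤ sunflowerPhi s t := by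
  classical
  refine (sunflowerPhi_isGreatest s t hs).2
    ⟨T.image fun A => A.map Fin.valEmbedding, ?_, ?_, ?_⟩
  · intro A hA
    obtain ⟨B, hB, rfl⟩ := Finset.mem_image.mp hA
    rw [Finset.card_map, hT B hB]
  · rintro ⟨S, hST, C, hS⟩
    obtain ⟨A, hAinj, hA, hAC⟩ := exists_system_of_isSunflower hS
    have hpre : ∀ i, ∃ B ∈ T, B.map Fin.valEmbedding = A i := fun i =>
      Finset.mem_image.mp (hST (hA i))
    choose B hBT hBA using hpre
    have h01 : (⟨0, by omega⟩ : Fin s) ≠ ⟨1, by omega⟩ := by simp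
    have hBC : ∀ i j, i ≠ j → (B i ∩ B j).map Fin.valEmbedding = C := by
      intro i j hij
      rw [Finset.map_inter, hBA, hBA, hAC i j hij]
    have hCt : (B ⟨0, by omega⟩ ∩ B ⟨1, by omega⟩).card < t :=
      card_inter_lt_of_ne (hT _ (hBT _)) (hT _ (hBT _)) fun h =>
        h01 (hAinj (by rw [← hBA, ← hBA, h]))
    refine hfree (containsSunflowerCoreLE_of_system s (t - 1) hs T B _ hBT (fun i j hij => ?_)
      (fun i => by rw [hT _ (hBT i)]; exact hCt) (by omega))
    exact Finset.map_injective _ ((hBC i j hij).trans (hBC _ _ h01).symm)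
  · exact Finset.card_image_of_injective _ (Finset.map_injective _)

/-- Each further prescribed point costs the factor (k-i)/(n-i) ≤ k/n. -/
theorem choose_le_pow_mul_choose (n k t i : ℕ) (hkn : k ≤ n) (hn : 0 < n) (hti : t ≤ i)
    (hik : i ≤ k) :
    ((n - i).choose (k - i) : ℝ) ≤ ((k : ℝ) / n) ^ (i - t) * (n - t).choose (k - t) := by
  have hn' : (0 : ℝ) < n := by exact_mod_cast hn
  induction i, hti using Nat.le_induction with
  | base => simp
  | succ i hti ih =>
    have ih := ih (by omega)
    have h1 := Nat.add_one_mul_choose_eq (n - (i + 1)) (k - (i + 1))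
    have e1 : n - (i + 1) + 1 = n - i := by omega
    have e2 : k - (i + 1) + 1 = k - i := by omega
    rw [e1, e2] at h1
    have h2 : ((n : ℝ) - i) * (n - (i + 1)).choose (k - (i + 1)) =
        (n - i).choose (k - i) * ((k : ℝ) - i) := by
      have := congrArg (Nat.cast (R := ℝ)) h1
      push_cast [Nat.cast_sub (show i ≤ n by omega), Nat.cast_sub (show i ≤ k by omega)] at this
      exact this
    have hni : (0 : ℝ) < (n : ℝ) - i := by
      have : (i : ℝ) + 1 ≤ n := by exact_mod_cast (by omega : i + 1 ≤ n)
      linarith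
    have hkn' : (k : ℝ) ≤ n := by exact_mod_cast hkn
    have h3 : (k : ℝ) - i ≤ (k : ℝ) / n * (n - i) := by
      rw [div_mul_eq_mul_div, le_div_iff₀ hn']
      have : (0 : ℝ) ≤ (i : ℝ) * (n - k) := mul_nonneg (Nat.cast_nonneg _) (by linarith)
      nlinarith
    have h4 : ((n - (i + 1)).choose (k - (i + 1)) : ℝ) ≤ (k : ℝ) / n * (n - i).choose (k - i) := by
      refine le_of_mul_le_mul_left ?_ hni
      rw [h2]
      calc _ ≤ ((n - i).choose (k - i) : ℝ) * ((k : ℝ) / n * (n - i)) := by gcongr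
        _ = _ := by ring
    calc _ ≤ _ := h4
      _ ≤ (k : ℝ) / n * (((k : ℝ) / n) ^ (i - t) * (n - t).choose (k - t)) := by gcongr
      _ = _ := by
        rw [Nat.sub_add_comm hti, pow_succ]
        ring

theorem card_filter_superset_le {n : ℕ} (k t : ℕ) (hkn : k ≤ n) (hn : 0 < n)
    (F : Finset (Finset (Fin n))) (hF : ∀ A ∈ F, A.card = k) (X : Finset (Fin n))
    (hX : t ≤ X.card) :
    ((F.filter fun A => X ⊆ A).card : ℝ) ≤
      ((k : ℝ) / n) ^ (X.card - t) * (n - t).choose (k - t) := by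
  classical
  rcases le_or_gt X.card k with hXk | hXk
  · refine le_trans ?_ (choose_le_pow_mul_choose n k t X.card hkn hn hX hXk)
    have h : (F.filter fun A => X ⊆ A).card ≤
        ((Finset.univ \ X).powersetCard (k - X.card)).card := by
      refine Finset.card_le_card_of_injOn (fun A => A \ X) ?_ ?_
      · intro A hA
        have hA' := Finset.mem_filter.mp hA
        refine Finset.mem_powersetCard.mpr
          ⟨Finset.sdiff_subset_sdiff (Finset.subset_univ _) (Finset.Subset.refl _), ?_⟩
        rw [Finset.card_sdiff_of_subset hA'.2, hF A hA'.1]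
      · intro A hA B hB hAB
        have hA' := Finset.mem_filter.mp hA
        have hB' := Finset.mem_filter.mp hB
        rw [← Finset.sdiff_union_of_subset hA'.2, ← Finset.sdiff_union_of_subset hB'.2]
        exact congrArg (· ∪ X) hAB
    rw [Finset.card_powersetCard, Finset.card_sdiff_of_subset (Finset.subset_univ _),
      Finset.card_univ, Fintype.card_fin] at h
    exact_mod_cast h
  · have h0 : (F.filter fun A => X ⊆ A) = ∅ := by
      refine Finset.filter_eq_empty_iff.mpr fun A hA hXA => ?_
      have := Finset.card_le_card hXA
      rw [hF A hA] at this
      omega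
    rw [h0]
    simp only [Finset.card_empty, Nat.cast_zero]
    positivity

/-! ### Logarithmic estimates -/

theorem one_add_le_two_rpow (w : ℝ) (hw : 1 ≤ w) : 1 + w ≤ (2 : ℝ) ^ w := by
  have := one_add_mul_self_le_rpow_one_add (s := 1) (by norm_num) hw
  norm_num at this
  linarith

theorem logb_two_natCast_le (i : ℕ) (hi : 1 ≤ i) : Real.logb 2 i ≤ i := by
  rw [Real.logb_le_iff_le_rpow (by norm_num) (by exact_mod_cast hi)]
  have := one_add_le_two_rpow i (by exact_mod_cast hi)
  linarith

theorem one_le_logb_two (t : ℝ) (ht : 2 ≤ t) : 1 ≤ Real.logb 2 t := by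
  rw [Real.le_logb_iff_rpow_le (by norm_num) (by linarith), Real.rpow_one]
  exact ht

/-- This trades log i for log t. With w = i/t, log₂ i = log₂ t + log₂ w ≤ (1 + w) log₂ t ≤ 2^w log₂
t, and the t-th power turns 2^w into 2^i. -/
theorem logb_pow_le (t i : ℕ) (ht : 2 ≤ t) (hti : t ≤ i) :
    Real.logb 2 i ^ t ≤ Real.logb 2 t ^ t * 2 ^ i := by
  have ht' : (2 : ℝ) ≤ t := by exact_mod_cast ht
  have ht0 : (0 : ℝ) < t := by linarith
  have hti' : (t : ℝ) ≤ i := by exact_mod_cast hti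
  have hlt := one_le_logb_two t ht'
  set w : ℝ := (i : ℝ) / t with hw
  have hw1 : 1 ≤ w := by rw [hw, le_div_iff₀ ht0]; linarith
  have hiw : (i : ℝ) = t * w := by rw [hw]; field_simp
  have h2w := one_add_le_two_rpow w hw1
  have hlw : Real.logb 2 w ≤ w := by
    rw [Real.logb_le_iff_le_rpow (by norm_num) (by linarith)]
    linarith
  have hlw0 : 0 ≤ Real.logb 2 w := Real.logb_nonneg (by norm_num) hw1
  have hmain : Real.logb 2 i ≤ Real.logb 2 t * (2 : ℝ) ^ w := by
    rw [hiw, Real.logb_mul (by linarith) (by linarith)]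
    nlinarith
  have hi0 : 0 ≤ Real.logb 2 (i : ℝ) := Real.logb_nonneg (by norm_num) (by linarith)
  calc _ ≤ (Real.logb 2 t * (2 : ℝ) ^ w) ^ t := by gcongr
    _ = _ := by
      rw [mul_pow, ← Real.rpow_mul_natCast (by norm_num)]
      congr 1
      rw [hw, div_mul_cancel₀ _ ht0.ne', Real.rpow_natCast]

theorem sum_Ioc_pow_le (t q : ℕ) (z : ℝ) (hz0 : 0 ≤ z) (hz : z ≤ 1 / 2) :
    ∑ i ∈ Finset.Ioc t q, z ^ (i - t) ≤ 2 * z := by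
  have h : Finset.Ioc t q = Finset.Ico (t + 1) (q + 1) := by
    ext i
    simp only [Finset.mem_Ioc, Finset.mem_Ico]
    omega
  rw [h, Finset.sum_Ico_eq_sum_range]
  calc _ ≤ ∑ j ∈ Finset.range (q + 1 - (t + 1)), (1 / 2 : ℝ) ^ j * z := by
        refine Finset.sum_le_sum fun j _ => ?_
        rw [show t + 1 + j - t = j + 1 by omega, pow_succ]
        gcongr
    _ = (∑ j ∈ Finset.range (q + 1 - (t + 1)), (1 / 2 : ℝ) ^ j) * z := by rw [Finset.sum_mul]
    _ ≤ 2 * z := by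
        gcongr
        exact sum_geometric_two_le _

/-- Two rounds more than halve the remainder, since (5/8)² < 1/2. The exponent has the form m + 1
with m = 2p - 1 to match the m + 1 colours in a group. -/
theorem five_eighths_pow_le (N p : ℕ) (hp : N < 2 ^ p) (hp0 : 0 < p) :
    (5 / 8 : ℝ) ^ (2 * p - 1 + 1) * N < 1 := by
  have h1 : (N : ℝ) < 2 ^ p := by exact_mod_cast hp
  rw [Nat.sub_add_cancel (by omega), pow_mul]
  calc ((5 / 8 : ℝ) ^ 2) ^ p * N ≤ (1 / 2) ^ p * N := by gcongr; norm_num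
    _ < (1 / 2) ^ p * 2 ^ p := by gcongr
    _ = 1 := by rw [← mul_pow]; norm_num

theorem card_layer_le_logb {α : Type*} [Fintype α] [DecidableEq α] (s t i q D : ℕ)
    (hs : 2 ≤ s) (ht : 2 ≤ t) (hti : t < i) (hiq : i ≤ q) (hD : 2 ^ 10 * s * q ≤ D)
    (T : Finset (Finset α)) (hfree : ¬ ContainsSunflowerCoreLE s (t - 1) T)
    (hT : ∀ Y, t ≤ Y.card → Y.card ≤ i →
      (T.filter fun A => A.card = i ∧ Y ⊆ A).card ≤ D ^ (i - Y.card)) :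
    ((T.filter fun A => A.card = i).card : ℝ) ≤
      (2 ^ 11 * s * Real.logb 2 t) ^ t * (2 * D : ℝ) ^ (i - t) := by
  have hs' : (2 : ℝ) ≤ s := by exact_mod_cast hs
  have hlog : 1 ≤ Real.logb 2 (i : ℝ) :=
    one_le_logb_two _ (by exact_mod_cast (by omega : 2 ≤ i))
  have hlogi : Real.logb 2 (i : ℝ) ≤ q :=
    (logb_two_natCast_le i (by omega)).trans (by exact_mod_cast hiq)
  have hlogt : 1 ≤ Real.logb 2 (t : ℝ) := one_le_logb_two _ (by exact_mod_cast ht)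
  -- Chosen so that 2i < 2^p; then 2p rounds suffice, and 128·s·2p ≤ 2^10 s log₂ i because log₂ i ≥
  -- 1.
  set p := Nat.log 2 i + 2 with hp
  have hpi : 2 * i < 2 ^ p := by
    have := Nat.lt_pow_succ_log_self (b := 2) (by norm_num) i
    rw [hp, show Nat.log 2 i + 2 = (Nat.log 2 i).succ + 1 from rfl, pow_succ]
    omega
  have hpl : (p : ℝ) ≤ Real.logb 2 i + 2 := by
    have := Real.natLog_le_logb i 2
    rw [hp]
    push_cast at this ⊢
    linarith
  have hm := five_eighths_pow_le (2 * i) p hpi (by omega)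
  have hlayer := card_layer_le s t i (2 * p - 1) D (2 ^ 10 * s * Real.logb 2 i) hs (by omega) hti
    T hfree hT (by positivity)
    (by
      calc (2 ^ 10 * s * Real.logb 2 i : ℝ) ≤ 2 ^ 10 * s * q := by gcongr
        _ ≤ D := by exact_mod_cast hD)
    (by
      have e : ((2 * p - 1 : ℕ) : ℝ) + 1 = 2 * p := by
        rw [Nat.cast_sub (by omega)]; push_cast; ring
      rw [e]
      nlinarith)
    (by push_cast at hm; linarith)
  refine hlayer.trans ?_
  have h1 := logb_pow_le t i ht hti.le
  calc _ = (2 ^ 10 * s : ℝ) ^ t * Real.logb 2 i ^ t * (D : ℝ) ^ (i - t) := by rw [mul_pow _ _ t]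
    _ ≤ (2 ^ 10 * s : ℝ) ^ t * (Real.logb 2 t ^ t * 2 ^ i) * (D : ℝ) ^ (i - t) := by gcongr
    _ = _ := by
      have e : (2 : ℝ) ^ i = 2 ^ t * 2 ^ (i - t) := by rw [← pow_add]; congr 1; omega
      rw [e, mul_pow _ _ (i - t), show (2 ^ 11 * s * Real.logb 2 t : ℝ) =
        (2 ^ 10 * s) * Real.logb 2 t * 2 by ring, mul_pow, mul_pow]
      ring

/-! ### Upper bound for t ≥ 2 -/

theorem card_covered_le {n : ℕ} (k s t q D : ℕ) (hs : 2 ≤ s) (ht : 2 ≤ t) (htk : t ≤ k)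
    (hkn : k ≤ n) (F T : Finset (Finset (Fin n))) (hF : ∀ A ∈ F, A.card = k)
    (hT : IsApproximation s t q F T)
    (hTD : ∀ i Y, t ≤ Y.card → Y.card ≤ i →
      (T.filter fun A => A.card = i ∧ Y ⊆ A).card ≤ D ^ (i - Y.card))
    (hD : 2 ^ 10 * s * q ≤ D) (hDn : 2 * D * ((k : ℝ) / n) ≤ 1 / 2) :
    (F.card : ℝ) ≤ (sunflowerPhi s t + (2 ^ 11 * s * Real.logb 2 t) ^ t *
      (4 * D * ((k : ℝ) / n))) * (n - t).choose (k - t) := by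
  classical
  have hn : 0 < n := by omega
  set y : ℝ := (k : ℝ) / n with hy
  have hy0 : 0 ≤ y := by positivity
  set Cb : ℝ := ((n - t).choose (k - t) : ℝ) with hCb
  have hlogt : 1 ≤ Real.logb 2 (t : ℝ) := one_le_logb_two _ (by exact_mod_cast ht)
  have hcov : F ⊆ T.biUnion fun X => F.filter fun A => X ⊆ A := by
    intro A hA
    obtain ⟨X, hX, hXA⟩ := hT.2.2 A hA
    exact Finset.mem_biUnion.mpr ⟨X, hX, Finset.mem_filter.mpr ⟨hA, hXA⟩⟩
  have h1 : (F.card : ℝ) ≤ ∑ X ∈ T, ((F.filter fun A => X ⊆ A).card : ℝ) := by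
    exact_mod_cast (Finset.card_le_card hcov).trans Finset.card_biUnion_le
  have h2 : ∑ X ∈ T, ((F.filter fun A => X ⊆ A).card : ℝ) ≤
      (∑ X ∈ T, y ^ (X.card - t)) * Cb := by
    rw [Finset.sum_mul]
    exact Finset.sum_le_sum fun X hX =>
      card_filter_superset_le k t hkn hn F hF X (hT.1 X hX).1
  -- The endpoint `max t q` keeps t in the range even when q < t.
  have h3 : ∑ X ∈ T, y ^ (X.card - t) =
      ∑ i ∈ Finset.Icc t (max t q), ((T.filter fun A => A.card = i).card : ℝ) * y ^ (i - t) := by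
    rw [← Finset.sum_fiberwise_of_maps_to (g := Finset.card) (t := Finset.Icc t (max t q))]
    · refine Finset.sum_congr rfl fun i _ => ?_
      rw [← nsmul_eq_mul, ← Finset.sum_const]
      exact Finset.sum_congr rfl fun X hX => by rw [(Finset.mem_filter.mp hX).2]
    · intro X hX
      have := hT.1 X hX
      exact Finset.mem_Icc.mpr ⟨this.1, this.2.trans (le_max_right _ _)⟩
  have h4 : ∑ i ∈ Finset.Ioc t (max t q), ((T.filter fun A => A.card = i).card : ℝ) * y ^ (i - t) ≤
      (2 ^ 11 * s * Real.logb 2 t) ^ t * (2 * (2 * D * y)) := by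
    calc _ ≤ ∑ i ∈ Finset.Ioc t (max t q),
          (2 ^ 11 * s * Real.logb 2 t) ^ t * (2 * D * y) ^ (i - t) := by
          refine Finset.sum_le_sum fun i hi => ?_
          rw [Finset.mem_Ioc] at hi
          rw [mul_pow _ y, ← mul_assoc]
          gcongr
          exact card_layer_le_logb s t i q D hs ht hi.1 (by omega) hD T hT.2.1 (hTD i)
      _ ≤ _ := by
          rw [← Finset.mul_sum]
          gcongr
          exact sum_Ioc_pow_le _ _ _ (by positivity) hDn
  have h5 : ((T.filter fun A => A.card = t).card : ℝ) ≤ sunflowerPhi s t := by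
    refine Nat.cast_le.mpr (card_le_sunflowerPhi s t hs _
      (fun A hA => (Finset.mem_filter.mp hA).2) ?_)
    rintro ⟨S, hS, h⟩
    exact hT.2.1 ⟨S, hS.trans (Finset.filter_subset _ _), h⟩
  rw [h3, ← Finset.Ioc_insert_left (le_max_left t q),
    Finset.sum_insert (by simp), Nat.sub_self, pow_zero, mul_one] at h2
  refine (h1.trans h2).trans ?_
  gcongr
  linarith

/-- Concentration on X gives at most (x/2)^{|X|} x^{-(|X|-t)} = x^t 2^{-|X|} times the binomial
coefficient, and |X| > q with 2^q ≥ x^{t+1} brings this below 1/x. -/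
theorem leftover_card_le {n : ℕ} (k t q : ℕ) (hkn : k ≤ n) (hk : 0 < k) (htq : t ≤ q)
    (F F' : Finset (Finset (Fin n))) (hF : ∀ A ∈ F, A.card = k) (r : ℝ) (hr0 : 0 < r)
    (hr : r ≤ (n : ℝ) / k / 2) (hq : ((n : ℝ) / k) ^ (t + 1) ≤ 2 ^ q)
    (hF' : F'.Nonempty → ∃ X : Finset (Fin n), q < X.card ∧
        (F'.card : ℝ) ≤ r ^ X.card * (F.filter fun A => X ⊆ A).card) :
    (F'.card : ℝ) ≤ (k : ℝ) / n * (n - t).choose (k - t) := by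
  have hk0 : (0 : ℝ) < k := by exact_mod_cast hk
  have hn0 : (0 : ℝ) < n := by exact_mod_cast (by omega : 0 < n)
  rcases F'.eq_empty_or_nonempty with rfl | hne
  · simp only [Finset.card_empty, Nat.cast_zero]
    positivity
  obtain ⟨X, hX, hc⟩ := hF' hne
  refine hc.trans ((mul_le_mul_of_nonneg_left
    (card_filter_superset_le k t hkn (by omega) F hF X (by omega)) (by positivity)).trans ?_)
  rw [← mul_assoc]
  gcongr
  set x : ℝ := (n : ℝ) / k with hx
  have hx0 : 0 < x := by positivity
  have hy : (k : ℝ) / n = x⁻¹ := by rw [hx, inv_div]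
  rw [hy]
  calc r ^ X.card * x⁻¹ ^ (X.card - t) ≤ (x / 2) ^ X.card * x⁻¹ ^ (X.card - t) := by gcongr
    _ = x ^ t * (1 / 2) ^ X.card := by
      have e : X.card = t + (X.card - t) := by omega
      have e' : x ^ X.card = x ^ t * x ^ (X.card - t) := by rw [← pow_add, ← e]
      have e'' : x ^ (X.card - t) * x⁻¹ ^ (X.card - t) = 1 := by
        rw [← mul_pow, mul_inv_cancel₀ hx0.ne', one_pow]
      have e3 : (1 / 2 : ℝ) ^ X.card = (2 ^ X.card)⁻¹ := by rw [one_div, inv_pow]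
      rw [div_pow, e', e3, div_eq_mul_inv]
      clear_value x
      linear_combination x ^ t * (2 ^ X.card)⁻¹ * e''
    _ ≤ x ^ t * (1 / 2) ^ q := by
      refine mul_le_mul_of_nonneg_left ?_ (by positivity)
      exact pow_le_pow_of_le_one (by norm_num) (by norm_num) hX.le
    _ ≤ x ^ t * (x ^ (t + 1))⁻¹ := by
      rw [one_div, inv_pow]
      gcongr
    _ = x⁻¹ := by
      rw [pow_succ, mul_inv, ← mul_assoc, mul_inv_cancel₀ (by positivity), one_mul]

theorem error_term_le (x P Q E w : ℝ) (hx : 0 < x) (hQP : Q ≤ P) (hQ : 0 ≤ Q) (hP : 1 ≤ P)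
    (hE : 1 ≤ E) (hw0 : 0 ≤ w) (hw : w ≤ 2 * E) :
    1 / x + Q * (4 * (2 ^ 13 * w) * (1 / x)) ≤ P * ((2 ^ 19 * E) / x) := by
  calc _ ≤ P * E * (1 / x) + P * (4 * (2 ^ 13 * (2 * E)) * (1 / x)) := by
        refine add_le_add (le_mul_of_one_le_left (by positivity) (by nlinarith)) ?_
        gcongr
    _ = P * E * (1 / x) * (1 + 2 ^ 16) := by ring
    _ ≤ P * E * (1 / x) * 2 ^ 19 := by
        gcongr
        norm_num
    _ = _ := by ring

set_option maxHeartbeats 400000 in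
theorem card_le_of_two_le (n k s t : ℕ) (hs : 2 ≤ s) (ht : 2 ≤ t) (htk : t ≤ k) (hkn : k ≤ n)
    (h1 : (n : ℝ) / k ≥ 2 ^ 18 * s * (t + 1) * Real.logb 2 ((n : ℝ) / k))
    (h2 : (n : ℝ) ≥ 2 ^ 15 * s * k * Real.logb 2 k)
    (F : Finset (Finset (Fin n))) (hF : ∀ A ∈ F, A.card = k)
    (hfree : ¬ ContainsSunflowerCoreLE s (t - 1) F) :
    (F.card : ℝ) ≤ sunflowerPhi s t * (n - t).choose (k - t) +
      (2 ^ 14 * s * Real.logb 2 t) ^ t *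
        ((2 ^ 19 * s * (t + 1) * Real.logb 2 ((n : ℝ) / k)) / ((n : ℝ) / k)) *
          (n - t).choose (k - t) := by
  classical
  have hs' : (2 : ℝ) ≤ s := by exact_mod_cast hs
  have ht' : (2 : ℝ) ≤ t := by exact_mod_cast ht
  have hk' : (2 : ℝ) ≤ k := by exact_mod_cast ht.trans htk
  have hk0 : (0 : ℝ) < k := by linarith
  have hn0 : (0 : ℝ) < n := by exact_mod_cast (by omega : 0 < n)
  have hlogt : 1 ≤ Real.logb 2 (t : ℝ) := one_le_logb_two _ ht'
  have hK := one_le_logb_two _ hk'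
  set K := Real.logb 2 (k : ℝ) with hKdef
  set x : ℝ := (n : ℝ) / k with hx
  have hx0 : 0 < x := by positivity
  have hxK : 2 ^ 15 * s * K ≤ x := by
    rw [hx, le_div_iff₀ hk0]
    linarith
  have hsK : (s : ℝ) ≤ s * K := le_mul_of_one_le_right (by linarith) hK
  have hxs : 2 ^ 15 * (s : ℝ) ≤ x := by linarith
  have hL : 1 ≤ Real.logb 2 x := one_le_logb_two _ (by linarith)
  set L := Real.logb 2 x with hLdef
  have htL : (t : ℝ) + 1 ≤ (t + 1) * L := le_mul_of_one_le_right (by linarith) hL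
  -- The least integer for which the condition 2^q ≥ x^{t+1} on the leftover is guaranteed.
  set q := ⌈((t : ℝ) + 1) * L⌉₊ with hq
  have hq1 : ((t : ℝ) + 1) * L ≤ q := Nat.le_ceil _
  have hq2 : (q : ℝ) ≤ 2 * ((t + 1) * L) := by
    have := Nat.ceil_lt_add_one (show (0 : ℝ) ≤ ((t : ℝ) + 1) * L by linarith)
    rw [← hq] at this
    linarith
  have hqL : 3 * L ≤ q := by nlinarith
  have htq : t ≤ q := by
    have : (t : ℝ) ≤ q := by linarith
    exact_mod_cast this
  have hsq : (s : ℝ) * q ≤ 2 * (s * (t + 1) * L) := by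
    calc (s : ℝ) * q ≤ s * (2 * ((t + 1) * L)) := by gcongr
      _ = _ := by ring
  have h1' : 2 ^ 18 * (s * (t + 1) * L) ≤ x := by linarith
  -- The q part leaves room to avoid a union of s sets of size at most q; q and K together cover the
  -- log₂(sk) ≤ L + K rounds of the union bound. The two lower bounds on x give r ≤ x/2.
  set r : ℝ := 2 ^ 13 * (s * (q + K)) with hr
  have hr0 : 0 < r := by positivity
  have hrx : r ≤ x / 2 := by
    rw [hr, mul_add]
    linarith
  set p := Nat.log 2 (s * k) + 1 with hp
  have hsk : s * k < 2 ^ p := Nat.lt_pow_succ_log_self (by norm_num) _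
  have hpl : (p : ℝ) ≤ L + K + 1 := by
    have h := Real.natLog_le_logb (s * k) 2
    have hsL : Real.logb 2 (s : ℝ) ≤ L :=
      Real.logb_le_logb_of_le (by norm_num) (by linarith) (by linarith)
    push_cast at h
    rw [Real.logb_mul (by linarith) (by linarith)] at h
    rw [hp]
    push_cast
    linarith
  have hm := five_eighths_pow_le (s * k) p hsk (by omega)
  obtain ⟨F', hF'F, T, hT, hF'⟩ := exists_isApproximation s t k q (2 * p - 1) hs (by omega) htk F hF
    r hr0 (by rw [hr]; nlinarith)
    (by
      have e : ((2 * p - 1 : ℕ) : ℝ) + 1 = 2 * p := by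
        rw [Nat.cast_sub (by omega)]; push_cast; ring
      rw [e, hr]
      nlinarith)
    (by push_cast at hm; linarith) hfree
  have hxq : x ^ (t + 1) ≤ 2 ^ q := by
    have e : x = (2 : ℝ) ^ L := (Real.rpow_logb (by norm_num) (by norm_num) hx0).symm
    rw [e, ← Real.rpow_mul_natCast (by norm_num), ← Real.rpow_natCast 2 q]
    refine Real.rpow_le_rpow_of_exponent_le (by norm_num) ?_
    push_cast
    linarith
  have hleft := leftover_card_le k t q hkn (by omega) htq F F' hF r hr0 hrx hxq hF'
  have hq0 : 0 < s * q := Nat.mul_pos (by omega) (by omega)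
  obtain ⟨T', hT', hTD⟩ := exists_reduced_approximation s t q (2 ^ 13 * (s * q)) hs (by omega)
    (F \ F') (by omega) ⟨T, hT⟩
  have hy : (k : ℝ) / n = 1 / x := by rw [hx, one_div_div]
  have hmain := card_covered_le k s t q (2 ^ 13 * (s * q)) hs ht htk hkn (F \ F') T'
    (fun A hA => hF A (Finset.mem_sdiff.mp hA).1) hT' hTD (by rw [mul_assoc]; omega) (by
      rw [hy, mul_one_div, div_le_iff₀ hx0]
      push_cast
      linarith)
  have hcard : (F.card : ℝ) = F'.card + (F \ F').card := by
    have := Finset.card_sdiff_add_card_eq_card hF'F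
    exact_mod_cast (by omega : F.card = F'.card + (F \ F').card)
  rw [hcard]
  rw [hy] at hleft hmain
  set Cb : ℝ := ((n - t).choose (k - t) : ℝ) with hCb
  have hCb0 : 0 ≤ Cb := Nat.cast_nonneg _
  set P : ℝ := (2 ^ 14 * s * Real.logb 2 t) ^ t with hP
  have hP1 : 1 ≤ P := by
    refine one_le_pow₀ (one_le_mul_of_one_le_of_one_le ?_ hlogt)
    linarith
  have hPle : (2 ^ 11 * s * Real.logb 2 (t : ℝ)) ^ t ≤ P := by
    rw [hP]
    gcongr <;> norm_num
  have hE : (1 : ℝ) ≤ s * (t + 1) * L :=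
    one_le_mul_of_one_le_of_one_le
      (one_le_mul_of_one_le_of_one_le (by linarith) (by linarith)) hL
  have herr : 1 / x + (2 ^ 11 * s * Real.logb 2 (t : ℝ)) ^ t *
      (4 * ((2 ^ 13 * (s * q) : ℕ) : ℝ) * (1 / x)) ≤
      P * ((2 ^ 19 * s * (t + 1) * L) / x) := by
    have h := error_term_le x P _ (s * (t + 1) * L) (s * q) hx0 hPle (by positivity) hP1 hE (by positivity) hsq
    rw [show 2 ^ 19 * (s : ℝ) * (t + 1) * L = 2 ^ 19 * (s * (t + 1) * L) by ring]
    rw [Nat.cast_mul, Nat.cast_mul, Nat.cast_pow, Nat.cast_ofNat]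
    exact h
  calc _ ≤ 1 / x * Cb + _ := add_le_add hleft hmain
    _ = sunflowerPhi s t * Cb + (1 / x + (2 ^ 11 * s * Real.logb 2 (t : ℝ)) ^ t *
      (4 * ((2 ^ 13 * (s * q) : ℕ) : ℝ) * (1 / x))) * Cb := by ring
    _ ≤ sunflowerPhi s t * Cb + P * ((2 ^ 19 * s * (t + 1) * L) / x) * Cb := by gcongr

/-! ### The cycle method for s pairwise disjoint sets -/

theorem strictMono_add_sub_le {N : ℕ} (e : Fin N → ℕ) (he : StrictMono e) (i d : ℕ)
    (h : i + d < N) : e ⟨i, by omega⟩ + d ≤ e ⟨i + d, h⟩ := by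
  induction d with
  | zero => exact le_rfl
  | succ d ih =>
    have h1 := ih (by omega)
    have h2 : e ⟨i + d, by omega⟩ < e ⟨i + (d + 1), h⟩ := he (Fin.mk_lt_mk.mpr (by omega))
    omega

/-- Among more than `(s - 1) * k` points of a cycle of length `n ≥ s * k` there are `s` points at
pairwise distance at least `k`. -/
theorem exists_separated_points (n k s : ℕ) (hk : 0 < k) (hs : 0 < s) (hn : s * k ≤ n)
    (P : Finset ℕ) (hP : P ⊆ Finset.range n) (hcard : (s - 1) * k < P.card) :
    ∃ a : Fin s → ℕ, (∀ i, a i ∈ P) ∧ ∀ i j, i < j → a i + k ≤ a j ∧ a j + k ≤ a i + n := by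
  classical
  have hsk : (s - 1) * k + k = s * k := by
    rw [← Nat.succ_mul]; congr 1; omega
  obtain ⟨P', hP'P, hP'c⟩ := Finset.exists_subset_card_eq (Nat.succ_le_of_lt hcard)
  obtain ⟨Q, hP'Q, hQn, hQc⟩ := Finset.exists_subsuperset_card_eq (hP'P.trans hP)
    (show P'.card ≤ s * k by omega) (by rw [Finset.card_range]; exact hn)
  set e := Q.orderEmbOfFin hQc with he
  have hlt : ∀ (ρ : Fin k) (j : Fin s), (j : ℕ) * k + ρ < s * k := by
    intro ρ j
    have h1 : (j : ℕ) * k ≤ (s - 1) * k := Nat.mul_le_mul_right _ (by have := j.2; omega)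
    have := ρ.2
    omega
  -- Split the sk sorted points of Q by index modulo k into k classes of s points. Only k - 1 points
  -- of Q lie outside P', so some class lies inside P'; its indices, hence its points, are at least
  -- k apart.
  obtain ⟨ρ, hρ⟩ : ∃ ρ : Fin k, ∀ j : Fin s, e ⟨j * k + ρ, hlt ρ j⟩ ∈ P' := by
    by_contra hno
    push Not at hno
    choose j hj using hno
    have h1 : (Finset.univ : Finset (Fin k)).card ≤ (Q \ P').card := by
      refine Finset.card_le_card_of_injOn (fun ρ => e ⟨j ρ * k + ρ, hlt ρ (j ρ)⟩) ?_ ?_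
      · intro ρ _
        exact Finset.mem_coe.mpr (Finset.mem_sdiff.mpr ⟨Finset.orderEmbOfFin_mem Q hQc _, hj ρ⟩)
      · intro ρ _ ρ' _ h
        have h2 := congrArg Fin.val (e.injective h)
        have h3 := congrArg (· % k) h2
        simp only [Nat.mul_add_mod', Nat.mod_eq_of_lt ρ.2, Nat.mod_eq_of_lt ρ'.2] at h3
        exact Fin.ext h3
    rw [Finset.card_univ, Fintype.card_fin, Finset.card_sdiff_of_subset hP'Q] at h1
    omega
  refine ⟨fun j => e ⟨j * k + ρ, hlt ρ j⟩, fun j => hP'P (hρ j), fun i j hij => ?_⟩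
  have hmul : (i : ℕ) * k + k ≤ j * k := by
    rw [← Nat.succ_mul]
    exact Nat.mul_le_mul_right _ hij
  have hjs := hlt ρ j
  have hjs' : (j : ℕ) * k ≤ (s - 1) * k := Nat.mul_le_mul_right _ (by have := j.2; omega)
  have hρk := ρ.2
  have hgap : ∀ u v : ℕ, ∀ (huv : u ≤ v) (hv : v < s * k),
      e ⟨u, by omega⟩ + (v - u) ≤ e ⟨v, hv⟩ := by
    intro u v huv hv
    have := strictMono_add_sub_le e e.strictMono u (v - u) (by omega)
    simpa only [Nat.add_sub_cancel' huv] using this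
  have hlast : e ⟨s * k - 1, by omega⟩ < n :=
    Finset.mem_range.mp (hQn (Finset.orderEmbOfFin_mem Q hQc _))
  have g1 := hgap (i * k + ρ) (j * k + ρ) (by omega) hjs
  have g2 := hgap (j * k + ρ) (s * k - 1) (by omega) (by omega)
  have g3 := hgap 0 (i * k + ρ) (by omega) (by omega)
  dsimp only
  constructor <;> omega

/-- The cyclic interval of length `k` starting at `a`. -/
def arc (n k a : ℕ) [NeZero n] : Finset (Fin n) :=
  (Finset.range k).image fun d => Fin.ofNat n (a + d)

theorem mod_ne_of_lt {n u v : ℕ} (h1 : u < v) (h2 : v < u + n) : u % n ≠ v % n := by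
  intro h
  have h3 := (Nat.modEq_iff_dvd' h1.le).mp h
  have := Nat.le_of_dvd (by omega) h3
  omega

theorem card_arc (n k a : ℕ) [NeZero n] (hkn : k ≤ n) : (arc n k a).card = k := by
  rw [arc, Finset.card_image_of_injOn, Finset.card_range]
  intro d hd d' hd' h
  have hd := Finset.mem_range.mp hd
  have hd' := Finset.mem_range.mp hd'
  have h' : (a + d) % n = (a + d') % n := congrArg Fin.val h
  rcases lt_trichotomy d d' with hlt | heq | hlt
  · exact absurd h' (mod_ne_of_lt (by omega) (by omega))
  · exact heq
  · exact absurd h'.symm (mod_ne_of_lt (by omega) (by omega))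

theorem disjoint_arc (n k a b : ℕ) [NeZero n] (h1 : a + k ≤ b) (h2 : b + k ≤ a + n) :
    Disjoint (arc n k a) (arc n k b) := by
  rw [Finset.disjoint_left]
  intro x hx hx'
  obtain ⟨d, hd, rfl⟩ := Finset.mem_image.mp hx
  obtain ⟨d', hd', h⟩ := Finset.mem_image.mp hx'
  rw [Finset.mem_range] at hd hd'
  have h' : (b + d') % n = (a + d) % n := congrArg Fin.val h
  exact mod_ne_of_lt (by omega) (by omega) h'.symm

theorem exists_perm_map_eq {α : Type*} [Fintype α] [DecidableEq α] (A B : Finset α)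
    (h : A.card = B.card) : ∃ τ : Equiv.Perm α, A.map τ.toEmbedding = B := by
  let e : {x // x ∈ A} ≃ {x // x ∈ B} := Finset.equivOfCardEq h
  refine ⟨e.extendSubtype, Finset.eq_of_subset_of_card_le ?_ (by rw [Finset.card_map, h])⟩
  intro y hy
  obtain ⟨x, hx, rfl⟩ := Finset.mem_map.mp hy
  exact e.extendSubtype_mem x hx

/-- A uniformly random permutation sends a fixed k-set to a uniformly random k-set: composing with a
permutation carrying B to A shows that all fibres are equally large. -/
theorem card_perm_map_mem {n : ℕ} (k : ℕ) (B : Finset (Fin n)) (hB : B.card = k)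
    (F : Finset (Finset (Fin n))) (hF : ∀ A ∈ F, A.card = k) :
    n.choose k * (Finset.univ.filter fun σ : Equiv.Perm (Fin n) =>
      B.map σ.toEmbedding ∈ F).card = F.card * n.factorial := by
  classical
  set N : Finset (Fin n) → ℕ := fun A =>
    (Finset.univ.filter fun σ : Equiv.Perm (Fin n) => B.map σ.toEmbedding = A).card with hN
  have hconst : ∀ A, A.card = k → N A = N B := by
    intro A hA
    obtain ⟨τ, hτ⟩ := exists_perm_map_eq B A (by rw [hA, hB])
    symm
    refine Finset.card_bij (fun σ _ => σ.trans τ) ?_ ?_ ?_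
    · intro σ hσ
      simp only [Finset.mem_filter, Finset.mem_univ, true_and] at hσ ⊢
      rw [← hτ]
      nth_rewrite 2 [← hσ]
      rw [Finset.map_map]
      rfl
    · intro σ _ σ' _ h
      ext x
      have := congrArg (fun f : Equiv.Perm (Fin n) => f x) h
      exact congrArg Fin.val (by simpa using this)
    · intro σ hσ
      simp only [Finset.mem_filter, Finset.mem_univ, true_and] at hσ
      refine ⟨σ.trans τ.symm, ?_, ?_⟩
      · simp only [Finset.mem_filter, Finset.mem_univ, true_and]
        have : B.map (σ.trans τ.symm).toEmbedding = (B.map σ.toEmbedding).map τ.symm.toEmbedding := by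
          rw [Finset.map_map]; rfl
        rw [this, hσ, ← hτ, Finset.map_map]
        ext x
        simp
      · ext x
        simp
  have hsum : ∀ G : Finset (Finset (Fin n)), (∀ A ∈ G, A.card = k) →
      (Finset.univ.filter fun σ : Equiv.Perm (Fin n) => B.map σ.toEmbedding ∈ G).card =
        G.card * N B := by
    intro G hG
    rw [Finset.card_eq_sum_card_fiberwise (f := fun σ : Equiv.Perm (Fin n) => B.map σ.toEmbedding)
      (t := G) (by intro σ hσ; exact (Finset.mem_filter.mp hσ).2)]
    rw [← smul_eq_mul, ← Finset.sum_const]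
    refine Finset.sum_congr rfl fun A hA => ?_
    rw [← hconst A (hG A hA)]
    simp only [hN]
    congr 1
    ext σ
    simp only [Finset.mem_filter, Finset.mem_univ, true_and]
    exact ⟨fun h => h.2, fun h => ⟨by rw [h]; exact hA, h⟩⟩
  have hall := hsum (Finset.powersetCard k Finset.univ) fun A hA => (Finset.mem_powersetCard.mp hA).2
  have hfull : (Finset.univ.filter fun σ : Equiv.Perm (Fin n) =>
      B.map σ.toEmbedding ∈ Finset.powersetCard k Finset.univ) = Finset.univ := by
    refine Finset.filter_true_of_mem fun σ _ => Finset.mem_powersetCard.mpr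
      ⟨Finset.subset_univ _, by rw [Finset.card_map, hB]⟩
  rw [hfull, Finset.card_univ, Fintype.card_perm, Fintype.card_fin, Finset.card_powersetCard,
    Finset.card_univ, Fintype.card_fin] at hall
  rw [hsum F hF, hall]
  ring

/-- Under each permutation at most (s-1)k of the n arcs land in F, since otherwise s pairwise
disjoint arcs would. Averaging over permutations gives the bound. -/
theorem card_le_of_no_disjoint {n : ℕ} (k s : ℕ) (hs : 2 ≤ s) (hk : 0 < k) (hn : s * k ≤ n)
    (F : Finset (Finset (Fin n))) (hF : ∀ A ∈ F, A.card = k)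
    (hfree : ¬ ContainsSunflowerCoreLE s 0 F) :
    F.card ≤ (s - 1) * (n - 1).choose (k - 1) := by
  classical
  have hkn : k ≤ n := le_trans (Nat.le_mul_of_pos_left k (by omega)) hn
  have hn0 : 0 < n := by omega
  have : NeZero n := ⟨hn0.ne'⟩
  have hσ : ∀ σ : Equiv.Perm (Fin n), ((Finset.range n).filter fun a =>
      (arc n k a).map σ.toEmbedding ∈ F).card ≤ (s - 1) * k := by
    intro σ
    by_contra hlt
    obtain ⟨a, haP, hsep⟩ := exists_separated_points n k s hk (by omega) hn _
      (Finset.filter_subset _ _) (not_le.mp hlt)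
    have hdis : ∀ i j, i < j → (arc n k (a i)).map σ.toEmbedding ∩
        (arc n k (a j)).map σ.toEmbedding = ∅ := by
      intro i j hij
      rw [← Finset.map_inter, Finset.disjoint_iff_inter_eq_empty.mp
        (disjoint_arc n k _ _ (hsep i j hij).1 (hsep i j hij).2), Finset.map_empty]
    refine hfree (containsSunflowerCoreLE_of_system s 0 hs F
      (fun i => (arc n k (a i)).map σ.toEmbedding) ∅ (fun i => (Finset.mem_filter.mp (haP i)).2)
      (fun i j hij => ?_) (fun i => ?_) (by simp))
    · rcases lt_or_gt_of_ne hij with h | h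
      · exact hdis i j h
      · rw [Finset.inter_comm]
        exact hdis j i h
    · rw [Finset.card_map, card_arc n k _ hkn, Finset.card_empty]
      exact hk
  have hdouble : ∑ a ∈ Finset.range n, (Finset.univ.filter fun σ : Equiv.Perm (Fin n) =>
      (arc n k a).map σ.toEmbedding ∈ F).card ≤ n.factorial * ((s - 1) * k) := by
    calc _ = ∑ σ : Equiv.Perm (Fin n), ((Finset.range n).filter fun a =>
          (arc n k a).map σ.toEmbedding ∈ F).card := by
          simp only [Finset.card_filter]
          exact Finset.sum_comm
      _ ≤ ∑ σ : Equiv.Perm (Fin n), (s - 1) * k := Finset.sum_le_sum fun σ _ => hσ σ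
      _ = _ := by
          rw [Finset.sum_const, Finset.card_univ, Fintype.card_perm, Fintype.card_fin, smul_eq_mul]
  have hmul := Nat.mul_le_mul_left (n.choose k) hdouble
  rw [Finset.mul_sum, Finset.sum_congr rfl fun a _ =>
    card_perm_map_mem k (arc n k a) (card_arc n k a hkn) F hF, Finset.sum_const, Finset.card_range,
    smul_eq_mul] at hmul
  have hch := Nat.add_one_mul_choose_eq (n - 1) (k - 1)
  rw [Nat.sub_add_cancel hn0, Nat.sub_add_cancel hk] at hch
  have hf := n.factorial_pos
  refine le_of_mul_le_mul_left ?_ (Nat.mul_pos hn0 hf)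
  calc n * n.factorial * F.card = n * (F.card * n.factorial) := by ring
    _ ≤ _ := hmul
    _ = n.factorial * (s - 1) * (n.choose k * k) := by ring
    _ = _ := by rw [← hch]; ring

/-! ### Lower bound construction -/

theorem exists_extremal_family (n s t : ℕ) (hs : 2 ≤ s) (h : t * sunflowerPhi s t < n) :
    ∃ T : Finset (Finset (Fin n)), (∀ A ∈ T, A.card = t) ∧ ¬ ContainsSunflower s T ∧
      T.card = sunflowerPhi s t := by
  classical
  obtain ⟨T, hTt, hTfree, hTc⟩ := (sunflowerPhi_isGreatest s t hs).1
  set U := T.biUnion id with hU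
  have hUc : U.card ≤ n := by
    have := Finset.card_biUnion_le_card_mul T id t fun A hA => (hTt A hA).le
    rw [hTc, mul_comm] at this
    exact this.trans h.le
  have : NeZero n := ⟨by omega⟩
  obtain ⟨f⟩ : Nonempty ({x // x ∈ U} ↪ Fin n) :=
    Function.Embedding.nonempty_of_card_le (by simpa using hUc)
  -- The value 0 off U is a default; only injectivity on U matters.
  set g : ℕ → Fin n := fun x => if hx : x ∈ U then f ⟨x, hx⟩ else 0 with hg
  have hginj : ∀ x ∈ U, ∀ y ∈ U, g x = g y → x = y := by
    intro x hx y hy hxy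
    simp only [hg, hx, hy, dif_pos] at hxy
    exact congrArg Subtype.val (f.injective hxy)
  have hTU : ∀ A ∈ T, A ⊆ U := fun A hA => Finset.subset_biUnion_of_mem id hA
  have himg : ∀ A ⊆ U, ∀ B ⊆ U, A.image g = B.image g → A ⊆ B := by
    intro A hA B hB hAB x hx
    have hxB : g x ∈ B.image g := hAB ▸ Finset.mem_image_of_mem g hx
    obtain ⟨y, hy, hyx⟩ := Finset.mem_image.mp hxB
    rw [← hginj y (hB hy) x (hA hx) hyx]
    exact hy
  have himg' : ∀ A ⊆ U, ∀ B ⊆ U, A.image g = B.image g → A = B := fun A hA B hB hAB =>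
    (himg A hA B hB hAB).antisymm (himg B hB A hA hAB.symm)
  have hcard : ∀ A ∈ T, (A.image g).card = t := by
    intro A hA
    rw [Finset.card_image_of_injOn fun x hx y hy => hginj x (hTU A hA hx) y (hTU A hA hy), hTt A hA]
  refine ⟨T.image fun A => A.image g, ?_, ?_, ?_⟩
  · intro A hA
    obtain ⟨B, hB, rfl⟩ := Finset.mem_image.mp hA
    exact hcard B hB
  · rintro ⟨S, hST, C, hS⟩
    obtain ⟨A, hAinj, hA, hAC⟩ := exists_system_of_isSunflower hS
    choose B hBT hBA using fun i => Finset.mem_image.mp (hST (hA i))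
    have h01 : (⟨0, by omega⟩ : Fin s) ≠ ⟨1, by omega⟩ := by simp
    have hBC : ∀ i j, i ≠ j → (B i ∩ B j).image g = C := by
      intro i j hij
      rw [Finset.image_inter_of_injOn, hBA, hBA, hAC i j hij]
      rintro x (hx | hx) y (hy | hy) <;>
        exact hginj x (hTU _ (hBT _) hx) y (hTU _ (hBT _) hy)
    have hlt : (B ⟨0, by omega⟩ ∩ B ⟨1, by omega⟩).card < t :=
      card_inter_lt_of_ne (hTt _ (hBT _)) (hTt _ (hBT _)) fun h =>
        h01 (hAinj (by rw [← hBA, ← hBA, h]))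
    obtain ⟨S', hS', C', h', -⟩ := containsSunflowerCoreLE_of_system s t hs T B _ hBT
      (fun i j hij => himg' _ (Finset.inter_subset_left.trans (hTU _ (hBT i))) _
        (Finset.inter_subset_left.trans (hTU _ (hBT _)))
        ((hBC i j hij).trans (hBC _ _ h01).symm))
      (fun i => by rw [hTt _ (hBT i)]; exact hlt) hlt.le
    exact hTfree ⟨S', hS', C', h'⟩
  · rw [Finset.card_image_of_injOn, hTc]
    intro A hA B hB hAB
    exact himg' A (hTU A hA) B (hTU B hB) hAB

theorem choose_le_choose_sub_add (N j m : ℕ) (hm : m ≤ N) (hj : 1 ≤ j) :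
    N.choose j ≤ (N - m).choose j + m * (N - 1).choose (j - 1) := by
  induction m with
  | zero => simp
  | succ m ih =>
    have h := ih (by omega)
    have hp : (N - m).choose j = (N - (m + 1)).choose (j - 1) + (N - (m + 1)).choose j := by
      obtain ⟨j', rfl⟩ : ∃ j', j = j' + 1 := ⟨j - 1, by omega⟩
      rw [show N - m = N - (m + 1) + 1 by omega, Nat.choose_succ_succ]
      rfl
    have hmono : (N - (m + 1)).choose (j - 1) ≤ (N - 1).choose (j - 1) :=
      Nat.choose_le_choose _ (by omega)
    rw [add_mul, one_mul]
    omega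

theorem choose_sub_ge (N j m : ℕ) (hN : 0 < N) (hm : m ≤ N) :
    (N.choose j : ℝ) - m * j / N * N.choose j ≤ (N - m).choose j := by
  rcases Nat.eq_zero_or_pos j with rfl | hj
  · simp
  have hN' : (0 : ℝ) < N := by exact_mod_cast hN
  have h1 : (N.choose j : ℝ) ≤ (N - m).choose j + m * (N - 1).choose (j - 1) := by
    exact_mod_cast choose_le_choose_sub_add N j m hm hj
  have h2 : ((N - 1).choose (j - 1) : ℝ) = j / N * N.choose j := by
    have h := Nat.add_one_mul_choose_eq (N - 1) (j - 1)
    rw [Nat.sub_add_cancel hN, Nat.sub_add_cancel hj] at h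
    have h' : (N : ℝ) * (N - 1).choose (j - 1) = N.choose j * j := by exact_mod_cast h
    rw [div_mul_eq_mul_div, eq_div_iff hN'.ne']
    linarith
  rw [h2] at h1
  have : (m : ℝ) * j / N * N.choose j = m * (j / N * N.choose j) := by ring
  linarith

/-- The `k`-sets meeting the support of an extremal `t`-uniform family in a member of the family. -/
theorem exists_large_family (n k s t : ℕ) (hs : 2 ≤ s) (ht : 1 ≤ t) (htk : t ≤ k)
    (hφ : 0 < sunflowerPhi s t) (h : t * sunflowerPhi s t < n) :
    ∃ F : Finset (Finset (Fin n)), F ⊆ Finset.powersetCard k Finset.univ ∧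
      ¬ ContainsSunflowerCoreLE s (t - 1) F ∧
      (F.card : ℝ) ≥ sunflowerPhi s t * (n - t).choose (k - t) -
        (t * (sunflowerPhi s t : ℝ) ^ 2 * ((k : ℝ) - t)) / ((n : ℝ) - t) *
          (n - t).choose (k - t) := by
  classical
  obtain ⟨T, hTt, hTfree, hTc⟩ := exists_extremal_family n s t hs h
  set φ := sunflowerPhi s t with hφdef
  set U := T.biUnion id with hU
  have hTU : ∀ A ∈ T, A ⊆ U := fun A hA => Finset.subset_biUnion_of_mem id hA
  have hUle : U.card ≤ t * φ := by
    have := Finset.card_biUnion_le_card_mul T id t fun A hA => (hTt A hA).le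
    rwa [hTc, mul_comm] at this
  have htU : t ≤ U.card := by
    obtain ⟨A, hA⟩ := Finset.card_pos.mp (hTc ▸ hφ)
    rw [← hTt A hA]
    exact Finset.card_le_card (hTU A hA)
  refine ⟨(Finset.powersetCard k Finset.univ).filter fun A => A ∩ U ∈ T,
    Finset.filter_subset _ _, ?_, ?_⟩
  · rintro ⟨S, hSF, C, hS, hCc⟩
    obtain ⟨A, -, hA, hAC⟩ := exists_system_of_isSunflower hS
    have hAT : ∀ i, A i ∩ U ∈ T := fun i => (Finset.mem_filter.mp (hSF (hA i))).2
    have hlt : (C ∩ U).card < t := by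
      have := Finset.card_le_card (Finset.inter_subset_left (s₁ := C) (s₂ := U))
      omega
    -- Traces on U meet pairwise in C ∩ U, which has fewer than t elements, so they are distinct and
    -- form a sunflower in T.
    obtain ⟨S', hS', C', h', -⟩ := containsSunflowerCoreLE_of_system s t hs T
      (fun i => A i ∩ U) (C ∩ U) hAT
      (fun i j hij => by
        rw [← hAC i j hij]
        ext x
        simp only [Finset.mem_inter]
        tauto)
      (fun i => by rw [hTt _ (hAT i)]; exact hlt) hlt.le
    exact hTfree ⟨S', hS', C', h'⟩
  · have hcount : φ * (n - U.card).choose (k - t) ≤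
        ((Finset.powersetCard k Finset.univ).filter fun A => A ∩ U ∈ T).card := by
      have hc : (T ×ˢ (Finset.univ \ U).powersetCard (k - t)).card =
          φ * (n - U.card).choose (k - t) := by
        rw [Finset.card_product, Finset.card_powersetCard,
          Finset.card_sdiff_of_subset (Finset.subset_univ _), Finset.card_univ, Fintype.card_fin,
          hTc]
      rw [← hc]
      have hdis : ∀ D, D ⊆ Finset.univ \ U → Disjoint D U := fun D hD =>
        Finset.disjoint_of_subset_left hD Finset.sdiff_disjoint
      have hint : ∀ B ∈ T, ∀ D ⊆ Finset.univ \ U, (B ∪ D) ∩ U = B := by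
        intro B hB D hD
        rw [Finset.union_inter_distrib_right, Finset.inter_eq_left.mpr (hTU B hB),
          Finset.disjoint_iff_inter_eq_empty.mp (hdis D hD), Finset.union_empty]
      have hsd : ∀ B ∈ T, ∀ D ⊆ Finset.univ \ U, (B ∪ D) \ U = D := by
        intro B hB D hD
        rw [Finset.union_sdiff_distrib, Finset.sdiff_eq_empty_iff_subset.mpr (hTU B hB),
          Finset.empty_union, Finset.sdiff_eq_self_of_disjoint (hdis D hD)]
      refine Finset.card_le_card_of_injOn (fun p => p.1 ∪ p.2) ?_ ?_
      · rintro ⟨B, D⟩ hp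
        obtain ⟨hB, hD⟩ := Finset.mem_product.mp hp
        obtain ⟨hD, hDc⟩ := Finset.mem_powersetCard.mp hD
        refine Finset.mem_filter.mpr ⟨Finset.mem_powersetCard.mpr ⟨Finset.subset_univ _, ?_⟩, ?_⟩
        · have hBD : Disjoint B D :=
            (Finset.disjoint_of_subset_right (hTU B hB) (hdis D hD)).symm
          change (B ∪ D).card = k
          rw [Finset.card_union_of_disjoint hBD, hTt B hB]
          have hDc' : D.card = k - t := hDc
          omega
        · change (B ∪ D) ∩ U ∈ T
          rw [hint B hB D hD]
          exact hB
      · rintro ⟨B, D⟩ hp ⟨B', D'⟩ hp' he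
        obtain ⟨hB, hD⟩ := Finset.mem_product.mp hp
        obtain ⟨hB', hD'⟩ := Finset.mem_product.mp hp'
        have hD := (Finset.mem_powersetCard.mp hD).1
        have hD' := (Finset.mem_powersetCard.mp hD').1
        have he' : B ∪ D = B' ∪ D' := he
        have e1 : B = B' := by rw [← hint B hB D hD, he', hint B' hB' D' hD']
        have e2 : D = D' := by rw [← hsd B hB D hD, he', hsd B' hB' D' hD']
        rw [e1, e2]
    have hN : 0 < n - t := by omega
    -- Outside U the k-set is free. Passing from n - t to n - |U| points costs the relative loss
    -- (|U| - t)(k - t)/(n - t), and |U| ≤ tφ.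
    have hm := choose_sub_ge (n - t) (k - t) (U.card - t) hN (by omega)
    rw [show n - t - (U.card - t) = n - U.card by omega, Nat.cast_sub htk,
      Nat.cast_sub (by omega : t ≤ n)] at hm
    have hcount' : (φ : ℝ) * (n - U.card).choose (k - t) ≤
        ((Finset.powersetCard k Finset.univ).filter fun A : Finset (Fin n) => A ∩ U ∈ T).card := by
      exact_mod_cast hcount
    have hN' : (0 : ℝ) < (n : ℝ) - t := by
      have : (t : ℝ) < n := by exact_mod_cast (by omega : t < n)
      linarith
    have hkt : (0 : ℝ) ≤ (k : ℝ) - t := by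
      have : (t : ℝ) ≤ k := by exact_mod_cast htk
      linarith
    have hUm : ((U.card - t : ℕ) : ℝ) ≤ t * φ := by
      exact_mod_cast (Nat.sub_le _ _).trans hUle
    refine ge_iff_le.mpr (le_trans ?_ ((mul_le_mul_of_nonneg_left hm (Nat.cast_nonneg φ)).trans
      hcount'))
    rw [mul_sub (φ : ℝ)]
    refine sub_le_sub_left ?_ _
    calc (φ : ℝ) * (((U.card - t : ℕ) : ℝ) * (k - t) / (n - t) * (n - t).choose (k - t)) ≤
        φ * ((t * φ) * (k - t) / (n - t) * (n - t).choose (k - t)) := by gcongr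
      _ = _ := by ring

theorem not_containsSunflowerCoreLE_of_card_lt {α : Type*} [DecidableEq α] (s c : ℕ)
    (F : Finset (Finset α)) (h : F.card < s) : ¬ ContainsSunflowerCoreLE s c F := by
  rintro ⟨S, hS, C, hSC, -⟩
  have := Finset.card_le_card hS
  rw [hSC.1] at this
  omega

theorem exists_family_lower_bound (n k s t : ℕ) (hs : 2 ≤ s) (ht : 1 ≤ t) (htk : t ≤ k)
    (hkn : k ≤ n) :
    ∃ F : Finset (Finset (Fin n)), F ⊆ Finset.powersetCard k Finset.univ ∧
      ¬ ContainsSunflowerCoreLE s (t - 1) F ∧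
      (F.card : ℝ) ≥ sunflowerPhi s t * (n - t).choose (k - t) -
        (t * (sunflowerPhi s t : ℝ) ^ 2) / ((n : ℝ) / k) * (n - t).choose (k - t) ∧
      (t * sunflowerPhi s t < n →
        (F.card : ℝ) ≥ sunflowerPhi s t * (n - t).choose (k - t) -
          (t * (sunflowerPhi s t : ℝ) ^ 2 * ((k : ℝ) - t)) / ((n : ℝ) - t) *
            (n - t).choose (k - t)) := by
  have hk0 : (0 : ℝ) < k := by exact_mod_cast (by omega : 0 < k)
  have hn0 : (0 : ℝ) < n := by exact_mod_cast (by omega : 0 < n)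
  have hempty := not_containsSunflowerCoreLE_of_card_lt s (t - 1) (∅ : Finset (Finset (Fin n)))
    (by rw [Finset.card_empty]; omega)
  rcases Nat.eq_zero_or_pos (sunflowerPhi s t) with h0 | hφ
  · exact ⟨∅, Finset.empty_subset _, hempty, by simp [h0], by simp [h0]⟩
  by_cases h : t * sunflowerPhi s t < n
  · obtain ⟨F, hF, hfree, hbound⟩ := exists_large_family n k s t hs ht htk hφ h
    refine ⟨F, hF, hfree, ?_, fun _ => hbound⟩
    refine ge_iff_le.mpr (le_trans (sub_le_sub_left ?_ _) hbound)
    have htn : t < n := lt_of_le_of_lt (Nat.le_mul_of_pos_right t hφ) h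
    have htn' : (0 : ℝ) < (n : ℝ) - t := by
      have : (t : ℝ) < n := by exact_mod_cast htn
      linarith
    have hkn' : (k : ℝ) ≤ n := by exact_mod_cast hkn
    refine mul_le_mul_of_nonneg_right ?_ (Nat.cast_nonneg _)
    rw [div_div_eq_mul_div, mul_div_assoc, mul_div_assoc]
    refine mul_le_mul_of_nonneg_left ?_ (by positivity)
    rw [div_le_div_iff₀ htn' hn0]
    nlinarith [mul_nonneg (Nat.cast_nonneg (α := ℝ) t) (sub_nonneg.mpr hkn')]
  -- When n ≤ tφ the claimed bound is at most 0, so the empty family serves.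
  · refine ⟨∅, Finset.empty_subset _, hempty, ?_, fun h' => absurd h' h⟩
    have hle : (n : ℝ) ≤ t * sunflowerPhi s t := by exact_mod_cast not_lt.mp h
    have hk1 : (1 : ℝ) ≤ k := by exact_mod_cast (by omega : 1 ≤ k)
    have hφle : (sunflowerPhi s t : ℝ) ≤ (t * (sunflowerPhi s t : ℝ) ^ 2) / ((n : ℝ) / k) := by
      rw [le_div_iff₀ (by positivity)]
      calc (sunflowerPhi s t : ℝ) * (n / k) ≤ sunflowerPhi s t * (n / 1) := by gcongr
        _ ≤ sunflowerPhi s t * (t * sunflowerPhi s t / 1) := by gcongr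
        _ = _ := by ring
    have := mul_le_mul_of_nonneg_right hφle
      (Nat.cast_nonneg (α := ℝ) ((n - t).choose (k - t)))
    rw [Finset.card_empty, Nat.cast_zero]
    linarith

/-! ### The case t = 1 and the conclusion -/

theorem sub_one_le_sunflowerPhi_one (s : ℕ) (hs : 2 ≤ s) : s - 1 ≤ sunflowerPhi s 1 := by
  refine (sunflowerPhi_isGreatest s 1 hs).2 ⟨(Finset.range (s - 1)).image fun x => {x}, ?_, ?_, ?_⟩
  · intro A hA
    obtain ⟨x, -, rfl⟩ := Finset.mem_image.mp hA
    exact Finset.card_singleton x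
  · rintro ⟨S, hS, C, hSC⟩
    have := (Finset.card_le_card hS).trans Finset.card_image_le
    rw [hSC.1, Finset.card_range] at this
    omega
  · rw [Finset.card_image_of_injective _ Finset.singleton_injective, Finset.card_range]

theorem card_le_of_eq_one (n k s : ℕ) (hs : 2 ≤ s) (hk : 1 ≤ k) (hkn : k ≤ n)
    (h1 : (n : ℝ) / k ≥ 2 ^ 18 * s * (1 + 1) * Real.logb 2 ((n : ℝ) / k))
    (h2 : (n : ℝ) ≥ 2 ^ 15 * s * k * Real.logb 2 k)
    (F : Finset (Finset (Fin n))) (hF : ∀ A ∈ F, A.card = k)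
    (hfree : ¬ ContainsSunflowerCoreLE s 0 F) :
    F.card ≤ sunflowerPhi s 1 * (n - 1).choose (k - 1) := by
  have hs' : (2 : ℝ) ≤ s := by exact_mod_cast hs
  refine le_trans ?_ (Nat.mul_le_mul_right _ (sub_one_le_sunflowerPhi_one s hs))
  by_cases hn : s * k ≤ n
  · exact card_le_of_no_disjoint k s hs hk hn F hF hfree
  have hn' : (n : ℝ) < s * k := by exact_mod_cast not_le.mp hn
  -- When n < sk the size hypotheses fail unless their logarithms vanish, which forces k = 1 and
  -- then n = 1.
  have hk1 : k = 1 := by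
    by_contra hne
    have hk2 : (2 : ℝ) ≤ k := by exact_mod_cast (by omega : 2 ≤ k)
    have := le_mul_of_one_le_right (show (0 : ℝ) ≤ 2 ^ 15 * s * k by positivity)
      (one_le_logb_two k hk2)
    have : (0 : ℝ) ≤ s * k := by positivity
    linarith
  subst hk1
  have hn1 : n = 1 := by
    by_contra hne
    have hn2 : (2 : ℝ) ≤ n := by exact_mod_cast (by omega : 2 ≤ n)
    rw [Nat.cast_one, div_one] at h1
    have := le_mul_of_one_le_right (show (0 : ℝ) ≤ 2 ^ 18 * s * (1 + 1) by positivity)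
      (one_le_logb_two n hn2)
    push_cast at hn'
    linarith
  subst hn1
  have hsub : F ⊆ Finset.powersetCard 1 Finset.univ := fun A hA =>
    Finset.mem_powersetCard.mpr ⟨Finset.subset_univ _, hF A hA⟩
  have := Finset.card_le_card hsub
  simp at this
  simp
  omega

theorem mainTheorem2 (n k s t : ℕ) (hs : 2 ≤ s) (ht : 1 ≤ t) (htk : t ≤ k) (hkn : k ≤ n) :
    ((n : ℝ) / k ≥ 2 ^ 18 * s * (t + 1) * Real.logb 2 ((n : ℝ) / k) →
      (n : ℝ) ≥ 2 ^ 15 * s * k * Real.logb 2 k →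
      ∀ F : Finset (Finset (Fin n)), F ⊆ Finset.powersetCard k Finset.univ →
        ¬ ContainsSunflowerCoreLE s (t - 1) F →
        (F.card : ℝ) ≤ sunflowerPhi s t * (n - t).choose (k - t) +
          (2 ^ 14 * s * Real.logb 2 t) ^ t *
            ((2 ^ 19 * s * (t + 1) * Real.logb 2 ((n : ℝ) / k)) / ((n : ℝ) / k)) *
              (n - t).choose (k - t)) ∧
    (∃ F : Finset (Finset (Fin n)), F ⊆ Finset.powersetCard k Finset.univ ∧
      ¬ ContainsSunflowerCoreLE s (t - 1) F ∧
      (F.card : ℝ) ≥ sunflowerPhi s t * (n - t).choose (k - t) -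
        (t * (sunflowerPhi s t : ℝ) ^ 2) / ((n : ℝ) / k) * (n - t).choose (k - t) ∧
      (t * sunflowerPhi s t < n →
        (F.card : ℝ) ≥ sunflowerPhi s t * (n - t).choose (k - t) -
          (t * (sunflowerPhi s t : ℝ) ^ 2 * ((k : ℝ) - t)) / ((n : ℝ) - t) *
            (n - t).choose (k - t))) := by
  refine ⟨fun h1 h2 F hF hfree => ?_, exists_family_lower_bound n k s t hs ht htk hkn⟩
  have hFk : ∀ A ∈ F, A.card = k := fun A hA => (Finset.mem_powersetCard.mp (hF hA)).2
  rcases ht.eq_or_lt with rfl | ht2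
  -- The error term is 0 here because log₂ 1 = 0.
  · have h := card_le_of_eq_one n k s hs htk hkn (by exact_mod_cast h1) h2 F hFk hfree
    have h' : (F.card : ℝ) ≤ sunflowerPhi s 1 * (n - 1).choose (k - 1) := by exact_mod_cast h
    simpa using h'
  · exact card_le_of_two_le n k s t hs ht2 htk hkn h1 h2 F hFk hfree
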